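/- Let $\theta\in[0,2\pi)$ with $\theta\notin\{0,\frac{\pi}{2},\pi,\frac{3\pi}{2}\}$, put $c=\cos\theta$, $s=\sin\theta$, and let $C=\begin{pmatrix}c&s\\ s&-c\end{pmatrix}$, acting on $\mathbb{C}^2$ with basis $|0\rangle,|1\rangle$. On $\ell^2(\mathbb{Z})\otimes\mathbb{C}^2$ let $\tilde C=\sum_{x\in\mathbb{Z}}|x\rangle\langle x|\otimes C$ and $\tilde S=\sum_{x\in\mathbb{Z}}\big(|x-1\rangle\langle x|\otimes|0\rangle\langle 0|+|x+1\rangle\langle x|\otimes|1\rangle\langle 1|\big)$. Let $\Psi_0=|0\rangle\otimes(\alpha|0\rangle+\beta|1\rangle)$ with $\alpha,\beta\in\mathbb{C}$, $|\alpha|^2+|\beta|^2=1$, and for $t=0,1,2,\dots$ let $\Psi_{t+1}=\tilde S\tilde C\Psi_t$ if $t\equiv 0,1 \pmod 3$ and $\Psi_{t+1}=\tilde S\Psi_t$ if $t\equiv 2\pmod 3$. Write $\Psi_t=\sum_{x}|x\rangle\otimes\psi_t(x)$ and let $X_t$ be a $\mathbb{Z}$-valued random variable with $\mathbb{P}(X_t=x)=\|\psi_t(x)\|^2$;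 this is a probability distribution for every $t$. Define $$D(x)=1+8c^2-9c^2x^2,$$ $$W_+(x)=-(1-4c^2)+3(1-2c^2)x^2+2|s|x\sqrt{D(x)},$$ $$W_-(x)=1+8c^2-3(1+2c^2)x^2-2|s|x\sqrt{D(x)},$$ $$f(x)=\frac{|s|\left(|s|x+\sqrt{D(x)}\right)^2}{\pi(1-x^2)\sqrt{W_+(x)}\sqrt{W_-(x)}\sqrt{D(x)}},$$ $$\nu(\alpha,\beta;x)=\frac{9c^3(|\alpha|^2-|\beta|^2)+3s(1+6c^2)\Re(\alpha\overline\beta)}{c(1+8c^2)}\,x+\frac{s\left\{cs(|\alpha|^2-|\beta|^2)-(1+2c^2)\Re(\alpha\overline\beta)\right\}}{c|s|(1+8c^2)}\sqrt{D(x)},$$ and, with $I_A$ the indicator function of $A$, $$p(y)=\{1-\nu(\alpha,\beta;y)\}f(y)\,I_{\left(\frac{1-4c^2}{3},\frac{\sqrt{1+8c^2}}{3}\right)}(y)+\{1+\nu(\alpha,\beta;-y)\}f(-y)\,I_{\left(-\frac{\sqrt{1+8c^2}}{3},-\frac{1-4c^2}{3}\right)}(y).$$ Then $p$ is a probability density on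 $\mathbb{R}$ (nonnegative, integrable, with integral $1$), and $X_{3t}/(3t)$ converges in distribution to the law with density $p$: for every $x\in\mathbb{R}$, $$\lim_{t\to\infty}\mathbb{P}\left(\frac{X_{3t}}{3t}\le x\right)=\int_{-\infty}^x p(y)\,dy.$$ -/

import Mathlib

open MeasureTheory Filter Topology

noncomputable section

namespace PeriodicQW

/-- States of the walker: `Ψ x j` is the amplitude of `|x⟩ ⊗ |j⟩`, with `x : ℤ` and `j = 0, 1`. -/
abbrev State : Type := ℤ → Fin 2 → ℂ

/-- The coin matrix with rows `(cos θ, sin θ)` and `(sin θ, - cos θ)`. -/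
def coin (θ : ℝ) : Matrix (Fin 2) (Fin 2) ℂ :=
  !![(Real.cos θ : ℂ), (Real.sin θ : ℂ); (Real.sin θ : ℂ), -(Real.cos θ : ℂ)]

/-- The coin operator `∑ₓ |x⟩⟨x| ⊗ C`. -/
def coinOp (C : Matrix (Fin 2) (Fin 2) ℂ) (Ψ : State) : State :=
  fun x => C.mulVec (Ψ x)

/-- The shift operator `∑ₓ |x - 1⟩⟨x| ⊗ |0⟩⟨0| + |x + 1⟩⟨x| ⊗ |1⟩⟨1|`. -/
def shiftOp (Ψ : State) : State :=
  fun x => ![Ψ (x + 1) 0, Ψ (x - 1) 1]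

/-- The initial state `|0⟩ ⊗ (α |0⟩ + β |1⟩)`. -/
def initialState (α β : ℂ) : State :=
  fun x => if x = 0 then ![α, β] else 0

/-- The state at time `t`: the step from `t` to `t + 1` is coin and then shift if
`t` is `0` or `1` mod `3`, and the shift alone if `t` is `2` mod `3`. -/
def state (θ : ℝ) (α β : ℂ) : ℕ → State
  | 0 => initialState α β
  | t + 1 =>
    if t % 3 = 2 then shiftOp (state θ α β t)
    else shiftOp (coinOp (coin θ) (state θ α β t))

/-- The probability of finding the walker at position `x` at time `t`. -/
def prob (θ : ℝ) (α β : ℂ) (t : ℕ) (x : ℤ) : ℝ :=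
  ‖state θ α β t x 0‖ ^ 2 + ‖state θ α β t x 1‖ ^ 2

/-- The distribution of the position `X_t` of the walker at time `t`. -/
def law (θ : ℝ) (α β : ℂ) (t : ℕ) : Measure ℤ :=
  Measure.sum fun x : ℤ => ENNReal.ofReal (prob θ α β t x) • Measure.dirac x

/-- `D(x) = 1 + 8c² - 9c²x²`. -/
def D (c x : ℝ) : ℝ := 1 + 8 * c ^ 2 - 9 * c ^ 2 * x ^ 2

/-- The function `W₊`. -/
def Wplus (c s x : ℝ) : ℝ :=
  -(1 - 4 * c ^ 2) + 3 * (1 - 2 * c ^ 2) * x ^ 2 + 2 * |s| * x * √(D c x)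

/-- The function `W₋`. -/
def Wminus (c s x : ℝ) : ℝ :=
  1 + 8 * c ^ 2 - 3 * (1 + 2 * c ^ 2) * x ^ 2 - 2 * |s| * x * √(D c x)

/-- The function `f`. -/
def f (c s x : ℝ) : ℝ :=
  |s| * (|s| * x + √(D c x)) ^ 2 /
    (Real.pi * (1 - x ^ 2) * √(Wplus c s x) * √(Wminus c s x) * √(D c x))

/-- The function `ν(α, β; x)`. -/
def nu (c s : ℝ) (α β : ℂ) (x : ℝ) : ℝ :=
  1 / (c * (1 + 8 * c ^ 2)) *
      (9 * c ^ 3 * (‖α‖ ^ 2 - ‖β‖ ^ 2) +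
        3 * s * (1 + 6 * c ^ 2) * (α * starRingEnd ℂ β).re) * x +
    s / (c * |s| * (1 + 8 * c ^ 2)) *
      (c * s * (‖α‖ ^ 2 - ‖β‖ ^ 2) -
        (1 + 2 * c ^ 2) * (α * starRingEnd ℂ β).re) * √(D c x)

/-- The limit density. -/
def density (c s : ℝ) (α β : ℂ) (y : ℝ) : ℝ :=
  (Set.Ioo ((1 - 4 * c ^ 2) / 3) (√(1 + 8 * c ^ 2) / 3)).indicator
      (fun y => (1 - nu c s α β y) * f c s y) y +
    (Set.Ioo (-(√(1 + 8 * c ^ 2) / 3)) (-((1 - 4 * c ^ 2) / 3))).indicator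
      (fun y => (1 + nu c s α β (-y)) * f c s (-y)) y

end PeriodicQW

end

/-!
Three steps of the walk commute with translations, so in momentum space they act on each fibre by a
matrix of determinant one, `cos ω(k) + i sin ω(k) H(k)`, where `H(k)` is a Hermitian involution
given by the Bloch vector `(blochX, blochY, blochZ)` divided by `sin ω(k)`. By de Moivre's formula
(`momentum_state_three_mul`) the `t`-th power is `cos tω(k) + i sin tω(k) H(k)`.

By Parseval (`charFun_map_law`), the characteristic function of `X_{3t} / (3t)` at `ξ` is the mean
over `k` of the overlap of the transformed state at the momenta `k` and `k - ξ / (3t)`. As `t → ∞`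
this overlap converges to `cos (ξ v) - i sin (ξ v) ⟨φ, H(k) φ⟩`, where `v = ω'(k) / 3` is the group
velocity and `φ = (α, β)` (`tendsto_overlap`); it is bounded by one, so the means converge.

Up to sign, the velocity is the same at `k`, `π - k`, `-k` and `k - π`, so the limit is an integral
over `(0, π / 2)`. There `velocity` decreases strictly from `√(1 + 8c²) / 3` to `(1 - 4c²) / 3`.
With `q = 4c² cos² k` and `Q = sineFactor`, everything in the definition of the density becomes
explicit at `y = velocity c k`: `√D = |s| (1 + 4c² + q) / √Q`, `W₊ = 12c² (1 - y²) cos² k` and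
`W₋ = 12c² (1 - y²) sin² k`. Hence `f` is `1 / π` times the Jacobian of the substitution
(`abs_velocityDeriv_mul_f`), and `ν` is the signed average of `⟨φ, H(k) φ⟩` over the four momenta
(`nu_velocity`), a number in `[-1, 1]`. The substitution thus gives nonnegativity, total mass one
and the characteristic function of the density, and Lévy's convergence theorem together with
the absolute continuity of the limit gives the convergence of the distribution functions.
-/

namespace PeriodicQW

/-! ### Momentum space and Parseval's identity -/

/-- The Fourier transform `∑ₓ e^{-ikx} Ψ(x)` of a state. -/
noncomputable def momentum (Ψ : State) (k : ℝ) (j : Fin 2) : ℂ :=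
  ∑' x : ℤ, Complex.exp (-((x : ℂ) * (k : ℂ) * Complex.I)) * Ψ x j

lemma finite_support_coinOp (C : Matrix (Fin 2) (Fin 2) ℂ) {Ψ : State}
    (h : (Function.support Ψ).Finite) : (Function.support (coinOp C Ψ)).Finite := by
  refine h.subset fun x hx hΨ => hx ?_
  simp [coinOp, hΨ]

lemma finite_support_shiftOp {Ψ : State} (h : (Function.support Ψ).Finite) :
    (Function.support (shiftOp Ψ)).Finite := by
  refine ((h.image (fun x => x - 1)).union (h.image (fun x => x + 1))).subset fun x hx => ?_
  by_contra hcon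
  simp only [Set.mem_union, Set.mem_image, Function.mem_support, not_or, not_exists,
    not_and] at hcon
  obtain ⟨h1, h2⟩ := hcon
  have e1 : Ψ (x + 1) = 0 := by
    by_contra h0; exact h1 _ h0 (by ring)
  have e2 : Ψ (x - 1) = 0 := by
    by_contra h0; exact h2 _ h0 (by ring)
  apply hx
  ext j
  fin_cases j <;> simp [shiftOp, e1, e2]

lemma finite_support_state (θ : ℝ) (α β : ℂ) (t : ℕ) :
    (Function.support (state θ α β t)).Finite := by
  induction t with
  | zero =>
    refine (Set.finite_singleton (0 : ℤ)).subset fun x hx => ?_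
    by_contra h0
    exact hx (by simp [state, initialState] at h0 ⊢; simp [h0])
  | succ t ih =>
    rw [state]
    split_ifs
    · exact finite_support_shiftOp ih
    · exact finite_support_shiftOp (finite_support_coinOp _ ih)

lemma summable_of_finite_support_state {Ψ : State} (h : (Function.support Ψ).Finite)
    (g : ℤ → ℂ) (j : Fin 2) : Summable fun x => g x * Ψ x j := by
  refine summable_of_hasFiniteSupport (h.subset fun x hx hΨ => hx ?_)
  simp [hΨ]

lemma momentum_coinOp (C : Matrix (Fin 2) (Fin 2) ℂ) {Ψ : State}
    (h : (Function.support Ψ).Finite) (k : ℝ) :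
    momentum (coinOp C Ψ) k = C.mulVec (momentum Ψ k) := by
  ext j
  simp only [momentum, coinOp, Matrix.mulVec, dotProduct, Fin.sum_univ_two]
  rw [← tsum_mul_left, ← tsum_mul_left, ← Summable.tsum_add]
  · exact tsum_congr fun x => by ring
  · exact (summable_of_finite_support_state h _ 0).mul_left _
  · exact (summable_of_finite_support_state h _ 1).mul_left _

lemma momentum_shiftOp_zero (Ψ : State) (k : ℝ) :
    momentum (shiftOp Ψ) k 0 = Complex.exp (k * Complex.I) * momentum Ψ k 0 := by
  simp only [momentum, shiftOp, Matrix.cons_val_zero]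
  rw [← (Equiv.addRight (1 : ℤ)).tsum_eq
    (fun x : ℤ => Complex.exp (-((x : ℂ) * (k : ℂ) * Complex.I)) * Ψ x 0), ← tsum_mul_left]
  refine tsum_congr fun x => ?_
  rw [← mul_assoc, ← Complex.exp_add, Equiv.coe_addRight]
  congr 2
  push_cast; ring

lemma momentum_shiftOp_one (Ψ : State) (k : ℝ) :
    momentum (shiftOp Ψ) k 1 = Complex.exp (-(k * Complex.I)) * momentum Ψ k 1 := by
  simp only [momentum, shiftOp, Matrix.cons_val_one, Matrix.cons_val_fin_one]
  rw [← (Equiv.subRight (1 : ℤ)).tsum_eq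
    (fun x : ℤ => Complex.exp (-((x : ℂ) * (k : ℂ) * Complex.I)) * Ψ x 1), ← tsum_mul_left]
  refine tsum_congr fun x => ?_
  rw [← mul_assoc, ← Complex.exp_add, Equiv.subRight_apply]
  congr 2
  push_cast; ring

lemma momentum_initialState (α β : ℂ) (k : ℝ) : momentum (initialState α β) k = ![α, β] := by
  ext j
  rw [momentum, tsum_eq_single 0]
  · simp [initialState]
  · intro x hx
    simp [initialState, hx]

lemma norm_sq_coin_mulVec (θ : ℝ) (v : Fin 2 → ℂ) :
    ‖(coin θ).mulVec v 0‖ ^ 2 + ‖(coin θ).mulVec v 1‖ ^ 2 = ‖v 0‖ ^ 2 + ‖v 1‖ ^ 2 := by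
  simp only [coin, Matrix.mulVec, dotProduct, Fin.sum_univ_two, Complex.sq_norm,
    Complex.normSq_apply]
  simp only [Matrix.of_apply, Matrix.cons_val_zero, Matrix.cons_val_one, Matrix.cons_val_fin_one,
    Complex.add_re, Complex.add_im, Complex.mul_re, Complex.mul_im, Complex.neg_re, Complex.neg_im,
    Complex.ofReal_re, Complex.ofReal_im]
  linear_combination ((v 0).re ^ 2 + (v 0).im ^ 2 + (v 1).re ^ 2 + (v 1).im ^ 2) *
    Real.sin_sq_add_cos_sq θ

lemma norm_sq_momentum_shiftOp (Ψ : State) (k : ℝ) :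
    ‖momentum (shiftOp Ψ) k 0‖ ^ 2 + ‖momentum (shiftOp Ψ) k 1‖ ^ 2 =
      ‖momentum Ψ k 0‖ ^ 2 + ‖momentum Ψ k 1‖ ^ 2 := by
  rw [momentum_shiftOp_zero, momentum_shiftOp_one, norm_mul, norm_mul,
    Complex.norm_exp_ofReal_mul_I, ← neg_mul, ← Complex.ofReal_neg, Complex.norm_exp_ofReal_mul_I,
    one_mul, one_mul]

/-- The one-step evolution is unitary on each fibre of momentum space. -/
lemma norm_sq_momentum_state (θ : ℝ) (α β : ℂ) (t : ℕ) (k : ℝ) :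
    ‖momentum (state θ α β t) k 0‖ ^ 2 + ‖momentum (state θ α β t) k 1‖ ^ 2 =
      ‖α‖ ^ 2 + ‖β‖ ^ 2 := by
  induction t with
  | zero => simp [state, momentum_initialState]
  | succ t ih =>
    rw [state]
    split_ifs
    · rw [norm_sq_momentum_shiftOp, ih]
    · rw [norm_sq_momentum_shiftOp, momentum_coinOp _ (finite_support_state θ α β t),
        norm_sq_coin_mulVec, ih]

lemma integral_exp_int_mul_I (n : ℤ) :
    ∫ k in (-Real.pi)..Real.pi, Complex.exp ((n : ℂ) * (k : ℂ) * Complex.I) =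
      if n = 0 then 2 * (Real.pi : ℂ) else 0 := by
  split_ifs with h
  · simp [h]; ring
  · have hn : (n : ℂ) * Complex.I ≠ 0 := mul_ne_zero (by exact_mod_cast h) Complex.I_ne_zero
    have : ∀ k : ℝ, Complex.exp ((n : ℂ) * (k : ℂ) * Complex.I) =
        Complex.exp ((n : ℂ) * Complex.I * k) := fun k => by ring_nf
    simp_rw [this]
    rw [integral_exp_mul_complex hn]
    have : Complex.exp ((n : ℂ) * Complex.I * (Real.pi : ℝ)) =
        Complex.exp ((n : ℂ) * Complex.I * ((-Real.pi : ℝ) : ℂ)) := by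
      rw [Complex.exp_eq_exp_iff_exists_int]
      exact ⟨n, by push_cast; ring⟩
    rw [this, sub_self, zero_div]

lemma continuous_momentum {Ψ : State} (h : (Function.support Ψ).Finite) (j : Fin 2) :
    Continuous fun k => momentum Ψ k j := by
  have : (fun k => momentum Ψ k j) = fun k : ℝ => ∑ x ∈ h.toFinset,
      Complex.exp (-((x : ℂ) * (k : ℂ) * Complex.I)) * Ψ x j := by
    ext k
    refine tsum_eq_sum fun x hx => ?_
    have : Ψ x = 0 := by simpa using hx
    simp [this]
  rw [this]
  fun_prop

/-- Parseval's identity: translating one factor by `η` in momentum space multiplies `|Ψ(x)|²`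
by `e^{iηx}`. -/
lemma integral_conj_momentum_mul_momentum_sub {Ψ : State} (h : (Function.support Ψ).Finite)
    (η : ℝ) (j : Fin 2) :
    ∫ k in (-Real.pi)..Real.pi, starRingEnd ℂ (momentum Ψ k j) * momentum Ψ (k - η) j =
      2 * Real.pi * ∑ x ∈ h.toFinset,
        ((‖Ψ x j‖ ^ 2 : ℝ) : ℂ) * Complex.exp ((η : ℂ) * (x : ℂ) * Complex.I) := by
  have hm : ∀ k : ℝ, momentum Ψ k j = ∑ x ∈ h.toFinset,
      Complex.exp (-((x : ℂ) * (k : ℂ) * Complex.I)) * Ψ x j := by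
    intro k
    refine tsum_eq_sum fun x hx => ?_
    have : Ψ x = 0 := by simpa using hx
    simp [this]
  have e : ∀ k : ℝ, starRingEnd ℂ (momentum Ψ k j) * momentum Ψ (k - η) j =
      ∑ x ∈ h.toFinset, ∑ y ∈ h.toFinset,
        (starRingEnd ℂ (Ψ x j) * Ψ y j * Complex.exp ((η : ℂ) * (y : ℂ) * Complex.I)) *
          Complex.exp (((x - y : ℤ) : ℂ) * (k : ℂ) * Complex.I) := by
    intro k
    rw [hm, hm, map_sum, Finset.sum_mul_sum]
    refine Finset.sum_congr rfl fun x _ => Finset.sum_congr rfl fun y _ => ?_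
    rw [map_mul, ← Complex.exp_conj]
    have h1 : starRingEnd ℂ (-((x : ℂ) * (k : ℂ) * Complex.I)) = (x : ℂ) * (k : ℂ) * Complex.I := by
      simp
    have h2 : Complex.exp ((x : ℂ) * (k : ℂ) * Complex.I) *
        Complex.exp (-((y : ℂ) * ((k - η : ℝ) : ℂ) * Complex.I)) =
        Complex.exp ((η : ℂ) * (y : ℂ) * Complex.I) *
          Complex.exp (((x - y : ℤ) : ℂ) * (k : ℂ) * Complex.I) := by
      rw [← Complex.exp_add, ← Complex.exp_add]
      congr 1
      push_cast; ring
    rw [h1]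
    linear_combination (starRingEnd ℂ (Ψ x j) * Ψ y j) * h2
  simp_rw [e]
  rw [intervalIntegral.integral_finsetSum, Finset.mul_sum]
  · refine Finset.sum_congr rfl fun x hx => ?_
    rw [intervalIntegral.integral_finsetSum, Finset.sum_eq_single x]
    · rw [intervalIntegral.integral_const_mul, integral_exp_int_mul_I, if_pos (sub_self x),
        ← Complex.normSq_eq_norm_sq, Complex.normSq_eq_conj_mul_self]
      ring
    · intro y _ hy
      rw [intervalIntegral.integral_const_mul, integral_exp_int_mul_I,
        if_neg (sub_ne_zero.2 hy.symm), mul_zero]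
    · exact fun hx' => absurd hx hx'
    · exact fun y _ => Continuous.intervalIntegrable (by fun_prop) _ _
  · exact fun x _ => Continuous.intervalIntegrable (by fun_prop) _ _

/-- The fibrewise inner product `⟨Ψ̂_t(k), Ψ̂_t(k')⟩` of the time-`t` state. -/
noncomputable def overlap (θ : ℝ) (α β : ℂ) (t : ℕ) (k k' : ℝ) : ℂ :=
  starRingEnd ℂ (momentum (state θ α β t) k 0) * momentum (state θ α β t) k' 0 +
    starRingEnd ℂ (momentum (state θ α β t) k 1) * momentum (state θ α β t) k' 1

lemma continuous_overlap (θ : ℝ) (α β : ℂ) (t : ℕ) {u v : ℝ → ℝ} (hu : Continuous u)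
    (hv : Continuous v) : Continuous fun k => overlap θ α β t (u k) (v k) := by
  have h := continuous_momentum (finite_support_state θ α β t)
  unfold overlap
  exact ((Complex.continuous_conj.comp ((h 0).comp hu)).mul ((h 0).comp hv)).add
    ((Complex.continuous_conj.comp ((h 1).comp hu)).mul ((h 1).comp hv))

lemma norm_overlap_le (θ : ℝ) {α β : ℂ} (hαβ : ‖α‖ ^ 2 + ‖β‖ ^ 2 = 1) (t : ℕ) (k k' : ℝ) :
    ‖overlap θ α β t k k'‖ ≤ 1 := by
  have h1 := norm_sq_momentum_state θ α β t k
  have h2 := norm_sq_momentum_state θ α β t k'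
  refine (norm_add_le _ _).trans ?_
  rw [norm_mul, norm_mul, RCLike.norm_conj, RCLike.norm_conj]
  nlinarith [sq_nonneg (‖momentum (state θ α β t) k 0‖ - ‖momentum (state θ α β t) k' 0‖),
    sq_nonneg (‖momentum (state θ α β t) k 1‖ - ‖momentum (state θ α β t) k' 1‖)]

lemma integral_overlap (θ : ℝ) (α β : ℂ) (t : ℕ) (η : ℝ) :
    ∫ k in (-Real.pi)..Real.pi, overlap θ α β t k (k - η) =
      2 * Real.pi * ∑ x ∈ (finite_support_state θ α β t).toFinset,
        (prob θ α β t x : ℂ) * Complex.exp ((η : ℂ) * (x : ℂ) * Complex.I) := by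
  have h := continuous_momentum (finite_support_state θ α β t)
  unfold overlap
  rw [intervalIntegral.integral_add,
    integral_conj_momentum_mul_momentum_sub (finite_support_state θ α β t),
    integral_conj_momentum_mul_momentum_sub (finite_support_state θ α β t), ← mul_add,
    ← Finset.sum_add_distrib]
  · congr 1
    refine Finset.sum_congr rfl fun x _ => ?_
    rw [prob]
    push_cast; ring
  · exact ((Complex.continuous_conj.comp (h 0)).mul
      ((h 0).comp (continuous_id.sub continuous_const))).intervalIntegrable _ _
  · exact ((Complex.continuous_conj.comp (h 1)).mul
      ((h 1).comp (continuous_id.sub continuous_const))).intervalIntegrable _ _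

lemma prob_nonneg (θ : ℝ) (α β : ℂ) (t : ℕ) (x : ℤ) : 0 ≤ prob θ α β t x := by
  unfold prob; positivity

lemma prob_eq_zero {θ : ℝ} {α β : ℂ} {t : ℕ} {x : ℤ}
    (hx : x ∉ (finite_support_state θ α β t).toFinset) : prob θ α β t x = 0 := by
  have : state θ α β t x = 0 := by simpa using hx
  simp [prob, this]

lemma sum_prob (θ : ℝ) {α β : ℂ} (hαβ : ‖α‖ ^ 2 + ‖β‖ ^ 2 = 1) (t : ℕ) :
    ∑ x ∈ (finite_support_state θ α β t).toFinset, prob θ α β t x = 1 := by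
  have h := integral_overlap θ α β t 0
  have h1 : ∀ k, overlap θ α β t k (k - 0) = 1 := by
    intro k
    rw [overlap, sub_zero, ← Complex.normSq_eq_conj_mul_self, ← Complex.normSq_eq_conj_mul_self,
      Complex.normSq_eq_norm_sq, Complex.normSq_eq_norm_sq, ← Complex.ofReal_add,
      norm_sq_momentum_state, hαβ, Complex.ofReal_one]
  simp only [h1, Complex.ofReal_zero, zero_mul, Complex.exp_zero, mul_one,
    intervalIntegral.integral_const, ← Complex.ofReal_sum] at h
  have hπ : (2 * Real.pi : ℝ) ≠ 0 := by positivity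
  have h' : 2 * Real.pi * 1 = 2 * Real.pi *
      ∑ x ∈ (finite_support_state θ α β t).toFinset, prob θ α β t x := by
    apply Complex.ofReal_injective
    push_cast
    push_cast at h
    rw [← h]
    simp; ring
  exact (mul_left_cancel₀ hπ h').symm

lemma law_singleton (θ : ℝ) (α β : ℂ) (t : ℕ) (x : ℤ) :
    law θ α β t {x} = ENNReal.ofReal (prob θ α β t x) := by
  rw [law, Measure.sum_smul_dirac_singleton]

lemma isProbabilityMeasure_law (θ : ℝ) {α β : ℂ} (hαβ : ‖α‖ ^ 2 + ‖β‖ ^ 2 = 1) (t : ℕ) :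
    IsProbabilityMeasure (law θ α β t) := by
  constructor
  rw [law, Measure.sum_apply _ MeasurableSet.univ]
  simp only [Measure.smul_apply, measure_univ, smul_eq_mul, mul_one]
  rw [tsum_eq_sum (s := (finite_support_state θ α β t).toFinset)
    fun x hx => by rw [prob_eq_zero hx, ENNReal.ofReal_zero],
    ← ENNReal.ofReal_sum_of_nonneg fun x _ => prob_nonneg θ α β t x, sum_prob θ hαβ,
    ENNReal.ofReal_one]

/-- The characteristic function of `a X_t` as an integral over momentum space. -/
lemma charFun_map_law (θ : ℝ) {α β : ℂ} (hαβ : ‖α‖ ^ 2 + ‖β‖ ^ 2 = 1) (t : ℕ) (a ξ : ℝ) :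
    charFun ((law θ α β t).map fun n : ℤ => (n : ℝ) * a) ξ =
      (2 * (Real.pi : ℂ))⁻¹ * ∫ k in (-Real.pi)..Real.pi, overlap θ α β t k (k - ξ * a) := by
  have := isProbabilityMeasure_law θ hαβ t
  have hπ : (2 * Real.pi : ℂ) ≠ 0 := by
    exact_mod_cast (by positivity : (2 * Real.pi : ℝ) ≠ 0)
  rw [integral_overlap, ← mul_assoc, inv_mul_cancel₀ hπ, one_mul, charFun_apply_real,
    integral_map (Measurable.aemeasurable (by fun_prop)) (by fun_prop)]
  rw [integral_countable]
  · rw [tsum_eq_sum (s := (finite_support_state θ α β t).toFinset)]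
    · refine Finset.sum_congr rfl fun x _ => ?_
      rw [measureReal_def, law_singleton, ENNReal.toReal_ofReal (prob_nonneg θ α β t x),
        Complex.real_smul]
      congr 2
      push_cast; ring
    · intro x hx
      rw [measureReal_def, law_singleton, prob_eq_zero hx]
      simp
  · refine Integrable.of_bound (C := 1) (by fun_prop) (ae_of_all _ fun x => ?_)
    rw [← Complex.ofReal_mul, Complex.norm_exp_ofReal_mul_I]

/-! ### The three-step evolution in momentum space -/

/-- `cos ω(k)`, where `e^{± iω(k)}` are the eigenvalues of the three-step evolution in momentum
space. -/
noncomputable def cosPhase (θ k : ℝ) : ℝ :=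
  (Real.cos k ^ 2 - Real.sin k ^ 2) * Real.cos k -
    2 * (Real.cos θ ^ 2 - Real.sin θ ^ 2) * Real.sin k ^ 2 * Real.cos k

/-- The coefficient of the Pauli matrix `σ_x` in the three-step evolution, divided by `i`. -/
noncomputable def blochX (θ k : ℝ) : ℝ :=
  2 * Real.sin θ * Real.cos θ * (Real.cos k ^ 2 - Real.sin k ^ 2) * Real.sin k

/-- The coefficient of the Pauli matrix `σ_y` in the three-step evolution, divided by `i`. -/
noncomputable def blochY (θ k : ℝ) : ℝ :=
  -(4 * Real.sin θ * Real.cos θ * Real.sin k ^ 2 * Real.cos k)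

/-- The coefficient of the Pauli matrix `σ_z` in the three-step evolution, divided by `i`. -/
noncomputable def blochZ (θ k : ℝ) : ℝ :=
  2 * Real.sin k * Real.cos k ^ 2 +
    (Real.cos θ ^ 2 - Real.sin θ ^ 2) * (Real.cos k ^ 2 - Real.sin k ^ 2) * Real.sin k

/-- The three-step evolution matrix has determinant `1`. -/
lemma cosPhase_sq_add_bloch_sq (θ k : ℝ) :
    cosPhase θ k ^ 2 + (blochX θ k ^ 2 + blochY θ k ^ 2 + blochZ θ k ^ 2) = 1 := by
  unfold cosPhase blochX blochY blochZ
  have h1 : Real.sin θ ^ 2 = 1 - Real.cos θ ^ 2 := Real.sin_sq θ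
  have h2 : Real.sin k ^ 2 = 1 - Real.cos k ^ 2 := Real.sin_sq k
  generalize Real.sin θ = s at *
  generalize Real.cos θ = c at *
  generalize Real.sin k = S at *
  generalize Real.cos k = C at *
  have h3 : C ^ 2 = 1 - S ^ 2 := by linarith
  have h4 : (s ^ 2 + c ^ 2) = 1 := by linarith
  have e : ((C ^ 2 - S ^ 2) * C - 2 * (c ^ 2 - s ^ 2) * S ^ 2 * C) ^ 2 +
      ((2 * s * c * (C ^ 2 - S ^ 2) * S) ^ 2 + (-(4 * s * c * S ^ 2 * C)) ^ 2 +
      (2 * S * C ^ 2 + (c ^ 2 - s ^ 2) * (C ^ 2 - S ^ 2) * S) ^ 2) =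
      (C ^ 2 + S ^ 2) ^ 2 * (C ^ 2 + (s ^ 2 + c ^ 2) ^ 2 * S ^ 2) := by ring
  rw [e, h4, h3]; ring

/-- Three steps act in momentum space by the matrix
`cos ω(k) + i (blochX σ_x + blochY σ_y + blochZ σ_z)`. -/
lemma momentum_state_three_mul_succ (θ : ℝ) (α β : ℂ) (t : ℕ) (k : ℝ) :
    momentum (state θ α β (3 * (t + 1))) k 0 =
        (cosPhase θ k + Complex.I * blochZ θ k) * momentum (state θ α β (3 * t)) k 0 +
          (Complex.I * blochX θ k + blochY θ k) * momentum (state θ α β (3 * t)) k 1 ∧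
      momentum (state θ α β (3 * (t + 1))) k 1 =
        (Complex.I * blochX θ k - blochY θ k) * momentum (state θ α β (3 * t)) k 0 +
          (cosPhase θ k - Complex.I * blochZ θ k) * momentum (state θ α β (3 * t)) k 1 := by
  have s1 : state θ α β (3 * t + 1) = shiftOp (coinOp (coin θ) (state θ α β (3 * t))) := by
    rw [state, if_neg (by omega)]
  have s2 : state θ α β (3 * t + 1 + 1) =
      shiftOp (coinOp (coin θ) (state θ α β (3 * t + 1))) := by
    rw [state, if_neg (by omega)]
  have s3 : state θ α β (3 * (t + 1)) = shiftOp (state θ α β (3 * t + 1 + 1)) := by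
    rw [show 3 * (t + 1) = 3 * t + 1 + 1 + 1 by ring, state, if_pos (by omega)]
  have f0 := finite_support_state θ α β (3 * t)
  have f1 := finite_support_state θ α β (3 * t + 1)
  have hI : Complex.I ^ 2 = -1 := Complex.I_sq
  have hz : Complex.exp (k * Complex.I) = Real.cos k + Real.sin k * Complex.I := by
    rw [Complex.exp_mul_I]; push_cast; rfl
  have hw : Complex.exp (-(k * Complex.I)) = Real.cos k - Real.sin k * Complex.I := by
    rw [← neg_mul, Complex.exp_mul_I, Complex.cos_neg, Complex.sin_neg]; push_cast; ring
  have hθ : (Real.sin θ : ℂ) ^ 2 + (Real.cos θ : ℂ) ^ 2 = 1 := by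
    exact_mod_cast Real.sin_sq_add_cos_sq θ
  have hz2 : ((Real.cos k : ℂ) + Real.sin k * Complex.I) ^ 2 =
      (Real.cos k : ℂ) ^ 2 - (Real.sin k : ℂ) ^ 2 + 2 * Real.sin k * Real.cos k * Complex.I := by
    linear_combination (Real.sin k : ℂ) ^ 2 * hI
  have hw2 : ((Real.cos k : ℂ) - Real.sin k * Complex.I) ^ 2 =
      (Real.cos k : ℂ) ^ 2 - (Real.sin k : ℂ) ^ 2 - 2 * Real.sin k * Real.cos k * Complex.I := by
    linear_combination (Real.sin k : ℂ) ^ 2 * hI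
  have step : ∀ Ψ : State, (Function.support Ψ).Finite →
      momentum (shiftOp (coinOp (coin θ) Ψ)) k 0 = (Real.cos k + Real.sin k * Complex.I) *
        (Real.cos θ * momentum Ψ k 0 + Real.sin θ * momentum Ψ k 1) ∧
      momentum (shiftOp (coinOp (coin θ) Ψ)) k 1 = (Real.cos k - Real.sin k * Complex.I) *
        (Real.sin θ * momentum Ψ k 0 - Real.cos θ * momentum Ψ k 1) := by
    intro Ψ h
    rw [momentum_shiftOp_zero, momentum_shiftOp_one, momentum_coinOp _ h, hz, hw]
    simp [coin, Matrix.mulVec, dotProduct, sub_eq_add_neg]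
  have e1 := step _ f0
  have e2 := step _ f1
  rw [← s1] at e1
  rw [← s2, e1.1, e1.2] at e2
  rw [s3, momentum_shiftOp_zero, momentum_shiftOp_one, e2.1, e2.2, hz, hw]
  clear s1 s2 s3 f0 f1 step e1 e2 hz hw
  simp only [cosPhase, blochX, blochY, blochZ, Complex.ofReal_add, Complex.ofReal_sub,
    Complex.ofReal_mul, Complex.ofReal_neg, Complex.ofReal_pow, Complex.ofReal_ofNat]
  generalize (Real.sin θ : ℂ) = s at *
  generalize (Real.cos θ : ℂ) = c at *
  generalize (Real.sin k : ℂ) = S at *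
  generalize (Real.cos k : ℂ) = C at *
  generalize momentum (state θ α β (3 * t)) k 0 = u
  generalize momentum (state θ α β (3 * t)) k 1 = v
  generalize Complex.I = i at *
  constructor
  · linear_combination (((C + S * i) * c ^ 2 + (C - S * i) * s ^ 2) * u +
      2 * s * c * S * i * v) * hz2 +
      (C ^ 2 - S ^ 2 + 2 * S * C * i) * C * u * hθ +
      (2 * S ^ 2 * C * (c ^ 2 - s ^ 2) * u + 4 * S ^ 2 * C * s * c * v) * hI
  · linear_combination (((C + S * i) * s ^ 2 + (C - S * i) * c ^ 2) * v +
      2 * s * c * S * i * u) * hw2 +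
      (C ^ 2 - S ^ 2 - 2 * S * C * i) * C * v * hθ +
      (2 * S ^ 2 * C * (c ^ 2 - s ^ 2) * v - 4 * S ^ 2 * C * s * c * u) * hI

/-- `sin ω(k)`, taken nonnegative. -/
noncomputable def sinPhase (θ k : ℝ) : ℝ := √(1 - cosPhase θ k ^ 2)

/-- The vector `H(k) (α, β)`, where `H(k)` is the Hermitian involution for which the three-step
evolution is `cos ω(k) + i sin ω(k) H(k)`. -/
noncomputable def involutionVec (θ : ℝ) (α β : ℂ) (k : ℝ) (j : Fin 2) : ℂ :=
  ![blochZ θ k * α + (blochX θ k - Complex.I * blochY θ k) * β,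
    (blochX θ k + Complex.I * blochY θ k) * α - blochZ θ k * β] j / sinPhase θ k

lemma one_sub_cosPhase_sq_nonneg (θ k : ℝ) : 0 ≤ 1 - cosPhase θ k ^ 2 := by
  rw [← cosPhase_sq_add_bloch_sq θ k, add_sub_cancel_left]
  positivity

lemma sinPhase_sq (θ k : ℝ) : sinPhase θ k ^ 2 = 1 - cosPhase θ k ^ 2 :=
  Real.sq_sqrt (one_sub_cosPhase_sq_nonneg θ k)

lemma sinPhase_sq_eq_bloch_sq (θ k : ℝ) :
    sinPhase θ k ^ 2 = blochX θ k ^ 2 + blochY θ k ^ 2 + blochZ θ k ^ 2 := by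
  linarith [sinPhase_sq θ k, cosPhase_sq_add_bloch_sq θ k]

lemma cos_arccos_cosPhase (θ k : ℝ) : Real.cos (Real.arccos (cosPhase θ k)) = cosPhase θ k := by
  have h := one_sub_cosPhase_sq_nonneg θ k
  exact Real.cos_arccos (by nlinarith) (by nlinarith)

lemma sin_arccos_cosPhase (θ k : ℝ) : Real.sin (Real.arccos (cosPhase θ k)) = sinPhase θ k :=
  Real.sin_arccos _

/-- De Moivre's formula for the powers of the three-step evolution. -/
lemma momentum_state_three_mul (θ : ℝ) (α β : ℂ) {k : ℝ} (hk : sinPhase θ k ≠ 0) (t : ℕ)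
    (j : Fin 2) :
    momentum (state θ α β (3 * t)) k j =
      Real.cos (t * Real.arccos (cosPhase θ k)) * ![α, β] j +
        Complex.I * Real.sin (t * Real.arccos (cosPhase θ k)) * involutionVec θ α β k j := by
  have hI : Complex.I ^ 2 = -1 := Complex.I_sq
  have hk' : (sinPhase θ k : ℂ) ≠ 0 := by exact_mod_cast hk
  have hb : (sinPhase θ k : ℂ) ^ 2 =
      (blochX θ k : ℂ) ^ 2 + (blochY θ k : ℂ) ^ 2 + (blochZ θ k : ℂ) ^ 2 := by
    exact_mod_cast sinPhase_sq_eq_bloch_sq θ k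
  have h0 : involutionVec θ α β k 0 * sinPhase θ k =
      blochZ θ k * α + (blochX θ k - Complex.I * blochY θ k) * β := by
    simp only [involutionVec, Matrix.cons_val_zero]; field_simp
  have h1 : involutionVec θ α β k 1 * sinPhase θ k =
      (blochX θ k + Complex.I * blochY θ k) * α - blochZ θ k * β := by
    simp only [involutionVec, Matrix.cons_val_one, Matrix.cons_val_fin_one]; field_simp
  have g0 : blochZ θ k * involutionVec θ α β k 0 +
      (blochX θ k - Complex.I * blochY θ k) * involutionVec θ α β k 1 = sinPhase θ k * α := by
    apply mul_right_cancel₀ hk'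
    linear_combination (blochZ θ k : ℂ) * h0 +
      ((blochX θ k : ℂ) - Complex.I * blochY θ k) * h1 - α * hb - (blochY θ k : ℂ) ^ 2 * α * hI
  have g1 : (blochX θ k + Complex.I * blochY θ k) * involutionVec θ α β k 0 -
      blochZ θ k * involutionVec θ α β k 1 = sinPhase θ k * β := by
    apply mul_right_cancel₀ hk'
    linear_combination ((blochX θ k : ℂ) + Complex.I * blochY θ k) * h0 -
      (blochZ θ k : ℂ) * h1 - β * hb - (blochY θ k : ℂ) ^ 2 * β * hI
  induction t generalizing j with
  | zero => simp [state, momentum_initialState]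
  | succ t ih =>
    obtain ⟨e0, e1⟩ := momentum_state_three_mul_succ θ α β t k
    have hc : Real.cos (((t + 1 : ℕ) : ℝ) * Real.arccos (cosPhase θ k)) =
        Real.cos (t * Real.arccos (cosPhase θ k)) * cosPhase θ k -
          Real.sin (t * Real.arccos (cosPhase θ k)) * sinPhase θ k := by
      rw [Nat.cast_add_one, add_one_mul, Real.cos_add, cos_arccos_cosPhase, sin_arccos_cosPhase]
    have hs : Real.sin (((t + 1 : ℕ) : ℝ) * Real.arccos (cosPhase θ k)) =
        Real.sin (t * Real.arccos (cosPhase θ k)) * cosPhase θ k +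
          Real.cos (t * Real.arccos (cosPhase θ k)) * sinPhase θ k := by
      rw [Nat.cast_add_one, add_one_mul, Real.sin_add, cos_arccos_cosPhase, sin_arccos_cosPhase]
    rw [hc, hs]
    simp only [Complex.ofReal_sub, Complex.ofReal_add, Complex.ofReal_mul]
    have i0 := ih 0
    have i1 := ih 1
    simp only [Matrix.cons_val_zero, Matrix.cons_val_one, Matrix.cons_val_fin_one] at i0 i1
    generalize (Real.cos (t * Real.arccos (cosPhase θ k)) : ℂ) = a at *
    generalize (Real.sin (t * Real.arccos (cosPhase θ k)) : ℂ) = b at *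
    fin_cases j
    · simp only [Fin.zero_eta, Matrix.cons_val_zero]
      rw [e0, i0, i1]
      linear_combination Complex.I ^ 2 * b * g0 - Complex.I * a * h0 +
        (b * sinPhase θ k * α + a * blochY θ k * β +
          Complex.I * b * blochY θ k * involutionVec θ α β k 1) * hI
    · simp only [Fin.mk_one, Matrix.cons_val_one, Matrix.cons_val_fin_one]
      rw [e1, i0, i1]
      linear_combination Complex.I ^ 2 * b * g1 - Complex.I * a * h1 +
        (b * sinPhase θ k * β - a * blochY θ k * α -
          Complex.I * b * blochY θ k * involutionVec θ α β k 0) * hI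

/-- The real number `⟨φ, H(k) φ⟩ sin ω(k)` for `φ = (α, β)`. -/
noncomputable def blochExpectation (θ : ℝ) (α β : ℂ) (k : ℝ) : ℝ :=
  blochZ θ k * (‖α‖ ^ 2 - ‖β‖ ^ 2) + 2 * blochX θ k * (α * starRingEnd ℂ β).re -
    2 * blochY θ k * (α * starRingEnd ℂ β).im

lemma conj_mul_involutionVec (θ : ℝ) (α β : ℂ) (k : ℝ) :
    starRingEnd ℂ α * involutionVec θ α β k 0 + starRingEnd ℂ β * involutionVec θ α β k 1 =
      ((blochExpectation θ α β k / sinPhase θ k : ℝ) : ℂ) := by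
  rw [Complex.ofReal_div]
  simp only [involutionVec, Matrix.cons_val_zero, Matrix.cons_val_one, Matrix.cons_val_fin_one]
  rw [mul_div_assoc', mul_div_assoc', ← add_div]
  congr 1
  apply Complex.ext
  · simp [blochExpectation, Complex.sq_norm, Complex.normSq_apply]
    ring
  · simp [blochExpectation, Complex.sq_norm, Complex.normSq_apply]
    ring

lemma conj_involutionVec_mul_involutionVec (θ : ℝ) {α β : ℂ} (hαβ : ‖α‖ ^ 2 + ‖β‖ ^ 2 = 1)
    {k : ℝ} (hk : sinPhase θ k ≠ 0) :
    starRingEnd ℂ (involutionVec θ α β k 0) * involutionVec θ α β k 0 +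
      starRingEnd ℂ (involutionVec θ α β k 1) * involutionVec θ α β k 1 = 1 := by
  simp only [involutionVec, Matrix.cons_val_zero, Matrix.cons_val_one, Matrix.cons_val_fin_one,
    map_div₀, Complex.conj_ofReal]
  have hk' : (sinPhase θ k : ℂ) ≠ 0 := by exact_mod_cast hk
  rw [div_mul_div_comm, div_mul_div_comm, ← add_div, div_eq_one_iff_eq (mul_ne_zero hk' hk')]
  rw [← Complex.normSq_eq_conj_mul_self, ← Complex.normSq_eq_conj_mul_self, ← Complex.ofReal_add,
    ← Complex.ofReal_mul, ← sq, sinPhase_sq_eq_bloch_sq]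
  congr 1
  rw [Complex.sq_norm, Complex.sq_norm] at hαβ
  simp only [Complex.normSq_apply] at hαβ ⊢
  simp
  linear_combination (blochX θ k ^ 2 + blochY θ k ^ 2 + blochZ θ k ^ 2) * hαβ

lemma continuous_cosPhase (θ : ℝ) : Continuous (cosPhase θ) := by unfold cosPhase; fun_prop
lemma continuous_blochX (θ : ℝ) : Continuous (blochX θ) := by unfold blochX; fun_prop
lemma continuous_blochY (θ : ℝ) : Continuous (blochY θ) := by unfold blochY; fun_prop
lemma continuous_blochZ (θ : ℝ) : Continuous (blochZ θ) := by unfold blochZ; fun_prop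
lemma continuous_sinPhase (θ : ℝ) : Continuous (sinPhase θ) := by
  have := continuous_cosPhase θ
  unfold sinPhase; fun_prop

lemma continuousAt_involutionVec (θ : ℝ) (α β : ℂ) {k : ℝ} (hk : sinPhase θ k ≠ 0) (j : Fin 2) :
    ContinuousAt (fun k => involutionVec θ α β k j) k := by
  have := continuous_blochX θ
  have := continuous_blochY θ
  have := continuous_blochZ θ
  have := continuous_sinPhase θ
  refine ContinuousAt.div ?_ (by fun_prop) (by exact_mod_cast hk)
  fin_cases j
  · simp only [Fin.zero_eta, Matrix.cons_val_zero]; fun_prop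
  · simp only [Fin.mk_one, Matrix.cons_val_one, Matrix.cons_val_fin_one]; fun_prop

/-! ### Group velocity and the limit of the overlaps -/

/-- The factor `1 - 4c² + 12c² cos² k` in the derivative `-sin k (1 - 4c² + 12c² cos² k)` of
`cos ω(k)`. -/
noncomputable def slopeFactor (c k : ℝ) : ℝ := 1 - 4 * c ^ 2 + 12 * c ^ 2 * Real.cos k ^ 2

/-- The factor `sin² ω(k) / sin² k`. -/
noncomputable def sineFactor (c k : ℝ) : ℝ :=
  1 + (2 - 4 * c ^ 2) * (4 * c ^ 2 * Real.cos k ^ 2) + (4 * c ^ 2 * Real.cos k ^ 2) ^ 2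

/-- The group velocity `ω'(k) / 3` for `0 < k < π`. -/
noncomputable def velocity (c k : ℝ) : ℝ := slopeFactor c k / (3 * √(sineFactor c k))

lemma sineFactor_pos {c : ℝ} (hc : c ^ 2 < 1) (k : ℝ) : 0 < sineFactor c k := by
  have h : sineFactor c k = (1 - 4 * c ^ 2 * Real.cos k ^ 2) ^ 2 +
      16 * (1 - c ^ 2) * (c ^ 2 * Real.cos k ^ 2) := by
    unfold sineFactor; ring
  rw [h]
  have h0 : 0 ≤ c ^ 2 * Real.cos k ^ 2 := by positivity
  rcases h0.eq_or_lt with h1 | h1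
  · rw [mul_assoc 4, ← h1]; norm_num
  · have : 0 < 1 - c ^ 2 := by linarith
    positivity

lemma sinPhase_eq (θ k : ℝ) :
    sinPhase θ k = |Real.sin k| * √(sineFactor (Real.cos θ) k) := by
  rw [sinPhase, ← Real.sqrt_sq_eq_abs, ← Real.sqrt_mul (sq_nonneg _)]
  congr 1
  unfold cosPhase sineFactor
  have h1 : Real.sin θ ^ 2 = 1 - Real.cos θ ^ 2 := Real.sin_sq θ
  have h2 : Real.sin k ^ 2 = 1 - Real.cos k ^ 2 := Real.sin_sq k
  rw [h1, h2]; ring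

lemma cos_sq_lt_one {θ : ℝ} (hs : Real.sin θ ≠ 0) : Real.cos θ ^ 2 < 1 := by
  have := Real.sin_sq_add_cos_sq θ
  have : 0 < Real.sin θ ^ 2 := by positivity
  linarith

lemma sinPhase_pos {θ : ℝ} (hs : Real.sin θ ≠ 0) {k : ℝ} (hk : Real.sin k ≠ 0) :
    0 < sinPhase θ k := by
  rw [sinPhase_eq]
  have := sineFactor_pos (cos_sq_lt_one hs) k
  positivity

lemma hasDerivAt_arccos_cosPhase {θ : ℝ} (hs : Real.sin θ ≠ 0) {k : ℝ} (hk : Real.sin k ≠ 0) :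
    HasDerivAt (fun k => Real.arccos (cosPhase θ k))
      (Real.sin k * slopeFactor (Real.cos θ) k / sinPhase θ k) k := by
  have hc : HasDerivAt (fun k => Real.cos k ^ 2) (2 * Real.cos k * -Real.sin k) k := by
    simpa using (Real.hasDerivAt_cos k).fun_pow 2
  have hsn : HasDerivAt (fun k => Real.sin k ^ 2) (2 * Real.sin k * Real.cos k) k := by
    simpa using (Real.hasDerivAt_sin k).fun_pow 2
  have h1 : HasDerivAt (cosPhase θ) (-(Real.sin k * slopeFactor (Real.cos θ) k)) k := by
    have := (((hc.sub hsn).mul (Real.hasDerivAt_cos k)).sub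
      ((hsn.const_mul (2 * (Real.cos θ ^ 2 - Real.sin θ ^ 2))).mul (Real.hasDerivAt_cos k)))
    refine this.congr_deriv ?_
    have h1 : Real.sin θ ^ 2 = 1 - Real.cos θ ^ 2 := Real.sin_sq θ
    have h2 : Real.cos k ^ 2 = 1 - Real.sin k ^ 2 := Real.cos_sq' k
    simp only [Pi.sub_apply]
    rw [slopeFactor, h1]
    linear_combination Real.sin k * (4 * Real.cos θ ^ 2 - 1) * h2
  have hp := sinPhase_pos hs hk
  have hp' := sinPhase_sq θ k
  have hne : 1 - cosPhase θ k ^ 2 ≠ 0 := by rw [← hp']; positivity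
  have h2 := (Real.hasDerivAt_arccos (x := cosPhase θ k) (fun h => hne (by rw [h]; norm_num))
    (fun h => hne (by rw [h]; norm_num))).comp k h1
  refine h2.congr_deriv ?_
  rw [← sinPhase]
  ring

/-- The phase difference over `t` periods, at momenta that are `ξ / (3t)` apart, converges. -/
lemma tendsto_mul_phase_sub {θ : ℝ} (hs : Real.sin θ ≠ 0) {k : ℝ} (hk : Real.sin k ≠ 0) (ξ : ℝ) :
    Tendsto (fun t : ℕ => (t : ℝ) * Real.arccos (cosPhase θ (k - ξ * (3 * (t : ℝ))⁻¹)) -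
        t * Real.arccos (cosPhase θ k)) atTop
      (𝓝 (-(ξ * (Real.sin k * slopeFactor (Real.cos θ) k / (3 * sinPhase θ k))))) := by
  have h0 := hasDerivAt_arccos_cosPhase hs hk
  have h1 : HasDerivAt (fun ε : ℝ => k - ξ / 3 * ε) (-(ξ / 3)) 0 := by
    simpa using ((hasDerivAt_id (0 : ℝ)).const_mul (ξ / 3)).const_sub k
  have h2 : HasDerivAt (fun ε : ℝ => Real.arccos (cosPhase θ (k - ξ / 3 * ε)))
      (Real.sin k * slopeFactor (Real.cos θ) k / sinPhase θ k * -(ξ / 3)) 0 :=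
    HasDerivAt.comp (h₂ := fun k => Real.arccos (cosPhase θ k)) 0 (by simpa using h0) h1
  have h3 : Tendsto (fun t : ℕ => ((t : ℝ))⁻¹) atTop (𝓝[≠] 0) :=
    (tendsto_inv_atTop_nhdsGT_zero.comp tendsto_natCast_atTop_atTop).mono_right
      (nhdsWithin_mono _ fun x hx => ne_of_gt hx)
  refine ((h2.tendsto_slope_zero.comp h3).congr fun t => ?_).trans_eq ?_
  · simp only [Function.comp, inv_inv, smul_eq_mul, zero_add, mul_zero, sub_zero]
    rw [show ξ * (3 * (t : ℝ))⁻¹ = ξ / 3 * (t : ℝ)⁻¹ by rw [mul_inv]; ring]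
    ring
  · congr 1
    have := (sinPhase_pos hs hk).ne'
    field_simp

/-- The overlap of the evolved state at nearby momenta: the rapidly oscillating terms carry factors
that vanish by continuity of the involution `H(k)`, and only the group velocity survives. -/
lemma tendsto_overlap {θ : ℝ} (hs : Real.sin θ ≠ 0) {α β : ℂ} (hαβ : ‖α‖ ^ 2 + ‖β‖ ^ 2 = 1)
    {k : ℝ} (hk : Real.sin k ≠ 0) (ξ : ℝ) :
    Tendsto (fun t : ℕ => overlap θ α β (3 * t) k (k - ξ * (3 * (t : ℝ))⁻¹)) atTop
      (𝓝 (Real.cos (ξ * (Real.sin k * slopeFactor (Real.cos θ) k / (3 * sinPhase θ k))) -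
        Complex.I * Real.sin (ξ * (Real.sin k * slopeFactor (Real.cos θ) k / (3 * sinPhase θ k))) *
          (blochExpectation θ α β k / sinPhase θ k : ℝ))) := by
  have hsk := (sinPhase_pos hs hk).ne'
  set v := Real.sin k * slopeFactor (Real.cos θ) k / (3 * sinPhase θ k) with hv
  set h : ℝ := blochExpectation θ α β k / sinPhase θ k with hh
  set ω : ℝ → ℝ := fun k => Real.arccos (cosPhase θ k) with hω
  set χ := involutionVec θ α β with hχ
  have hφ : Tendsto (fun t : ℕ => (t : ℝ) * ω (k - ξ * (3 * (t : ℝ))⁻¹) - t * ω k) atTop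
      (𝓝 (-(ξ * v))) := tendsto_mul_phase_sub hs hk ξ
  have hk' : Tendsto (fun t : ℕ => k - ξ * (3 * (t : ℝ))⁻¹) atTop (𝓝 k) := by
    have h3 : Tendsto (fun t : ℕ => ((3 * (t : ℝ)))⁻¹) atTop (𝓝 0) :=
      tendsto_inv_atTop_zero.comp
        (tendsto_natCast_atTop_atTop.const_mul_atTop (by norm_num : (0 : ℝ) < 3))
    simpa using (h3.const_mul ξ).const_sub k
  have hχ0 : Tendsto (fun t : ℕ => χ (k - ξ * (3 * (t : ℝ))⁻¹) 0) atTop (𝓝 (χ k 0)) :=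
    (continuousAt_involutionVec θ α β hsk 0).tendsto.comp hk'
  have hχ1 : Tendsto (fun t : ℕ => χ (k - ξ * (3 * (t : ℝ))⁻¹) 1) atTop (𝓝 (χ k 1)) :=
    (continuousAt_involutionVec θ α β hsk 1).tendsto.comp hk'
  have hG := conj_mul_involutionVec θ α β k
  have hG' : starRingEnd ℂ (χ k 0) * α + starRingEnd ℂ (χ k 1) * β = h := by
    have := congrArg (starRingEnd ℂ) hG
    rw [map_add, map_mul, map_mul, Complex.conj_conj, Complex.conj_conj, Complex.conj_ofReal]
      at this
    rw [hh, ← this]; ring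
  have hφφ : starRingEnd ℂ α * α + starRingEnd ℂ β * β = 1 := by
    rw [← Complex.normSq_eq_conj_mul_self, ← Complex.normSq_eq_conj_mul_self,
      Complex.normSq_eq_norm_sq, Complex.normSq_eq_norm_sq, ← Complex.ofReal_add, hαβ,
      Complex.ofReal_one]
  -- The two error terms, multiplied by bounded oscillating factors.
  have hE1 : Tendsto (fun t : ℕ => starRingEnd ℂ α * χ (k - ξ * (3 * (t : ℝ))⁻¹) 0 +
      starRingEnd ℂ β * χ (k - ξ * (3 * (t : ℝ))⁻¹) 1 - h) atTop (𝓝 0) := by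
    have := ((hχ0.const_mul (starRingEnd ℂ α)).add (hχ1.const_mul (starRingEnd ℂ β))).sub_const
      (h : ℂ)
    rwa [hG, sub_self] at this
  have hE2 : Tendsto (fun t : ℕ => starRingEnd ℂ (χ k 0) * χ (k - ξ * (3 * (t : ℝ))⁻¹) 0 +
      starRingEnd ℂ (χ k 1) * χ (k - ξ * (3 * (t : ℝ))⁻¹) 1 - 1) atTop (𝓝 0) := by
    have := ((hχ0.const_mul (starRingEnd ℂ (χ k 0))).add
      (hχ1.const_mul (starRingEnd ℂ (χ k 1)))).sub_const (1 : ℂ)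
    rwa [conj_involutionVec_mul_involutionVec θ hαβ hsk, sub_self] at this
  have hbdd : ∀ a b : ℕ → ℝ, (∀ t, |a t| ≤ 1) → (∀ t, |b t| ≤ 1) → ∀ E : ℕ → ℂ,
      Tendsto E atTop (𝓝 0) → Tendsto (fun t => ((a t * b t : ℝ) : ℂ) * E t) atTop (𝓝 0) := by
    intro a b ha hb E hE
    refine squeeze_zero_norm (fun t => ?_) (tendsto_zero_iff_norm_tendsto_zero.1 hE)
    rw [norm_mul, Complex.norm_real, Real.norm_eq_abs, abs_mul]
    have : |a t| * |b t| ≤ 1 := mul_le_one₀ (ha t) (abs_nonneg _) (hb t)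
    nlinarith [norm_nonneg (E t)]
  have hR1 := (hbdd (fun t => Real.cos (t * ω k))
    (fun t => Real.sin (t * ω (k - ξ * (3 * (t : ℝ))⁻¹))) (fun t => Real.abs_cos_le_one _)
    (fun t => Real.abs_sin_le_one _) _ hE1).const_mul Complex.I
  have hR2 := hbdd (fun t => Real.sin (t * ω k))
    (fun t => Real.sin (t * ω (k - ξ * (3 * (t : ℝ))⁻¹))) (fun t => Real.abs_sin_le_one _)
    (fun t => Real.abs_sin_le_one _) _ hE2
  have hM1 : Tendsto (fun t : ℕ =>
      (Real.cos ((t : ℝ) * ω (k - ξ * (3 * (t : ℝ))⁻¹) - t * ω k) : ℂ)) atTop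
      (𝓝 (Real.cos (ξ * v) : ℂ)) := by
    have := (Complex.continuous_ofReal.tendsto _).comp ((Real.continuous_cos.tendsto _).comp hφ)
    rwa [Real.cos_neg] at this
  have hM2 : Tendsto (fun t : ℕ =>
      (Real.sin ((t : ℝ) * ω (k - ξ * (3 * (t : ℝ))⁻¹) - t * ω k) : ℂ)) atTop
      (𝓝 (-Real.sin (ξ * v) : ℂ)) := by
    have := (Complex.continuous_ofReal.tendsto _).comp ((Real.continuous_sin.tendsto _).comp hφ)
    rwa [Real.sin_neg, Complex.ofReal_neg] at this
  have hsum := ((hM1.add ((hM2.const_mul Complex.I).mul_const (h : ℂ))).add hR1).add hR2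
  have hev : ∀ᶠ t : ℕ in atTop, sinPhase θ (k - ξ * (3 * (t : ℝ))⁻¹) ≠ 0 :=
    hk'.eventually ((continuous_sinPhase θ).continuousAt.eventually_ne hsk)
  refine Tendsto.congr' ?_ (hsum.trans_eq ?_)
  · filter_upwards [hev] with t ht
    simp only [overlap, momentum_state_three_mul θ α β hsk, momentum_state_three_mul θ α β ht,
      Matrix.cons_val_zero, Matrix.cons_val_one, Matrix.cons_val_fin_one, map_add, map_mul,
      Complex.conj_ofReal, Complex.conj_I]
    rw [Real.cos_sub, Real.sin_sub]
    simp only [Complex.ofReal_sub, Complex.ofReal_add, Complex.ofReal_mul]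
    change _ = ((Real.cos (t * ω k) : ℂ) * starRingEnd ℂ α +
      -Complex.I * (Real.sin (t * ω k) : ℂ) * starRingEnd ℂ (χ k 0)) *
      ((Real.cos (t * ω (k - ξ * (3 * (t : ℝ))⁻¹)) : ℂ) * α +
      Complex.I * (Real.sin (t * ω (k - ξ * (3 * (t : ℝ))⁻¹)) : ℂ) *
        χ (k - ξ * (3 * (t : ℝ))⁻¹) 0) +
      ((Real.cos (t * ω k) : ℂ) * starRingEnd ℂ β +
      -Complex.I * (Real.sin (t * ω k) : ℂ) * starRingEnd ℂ (χ k 1)) *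
      ((Real.cos (t * ω (k - ξ * (3 * (t : ℝ))⁻¹)) : ℂ) * β +
      Complex.I * (Real.sin (t * ω (k - ξ * (3 * (t : ℝ))⁻¹)) : ℂ) *
        χ (k - ξ * (3 * (t : ℝ))⁻¹) 1)
    generalize (Real.cos (t * ω k) : ℂ) = a
    generalize (Real.sin (t * ω k) : ℂ) = b
    generalize (Real.cos (t * ω (k - ξ * (3 * (t : ℝ))⁻¹)) : ℂ) = a'
    generalize (Real.sin (t * ω (k - ξ * (3 * (t : ℝ))⁻¹)) : ℂ) = b'
    generalize χ (k - ξ * (3 * (t : ℝ))⁻¹) 0 = x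
    generalize χ (k - ξ * (3 * (t : ℝ))⁻¹) 1 = y
    linear_combination (-(a * a')) * hφφ + Complex.I * b * a' * hG' +
      (b * b' * (starRingEnd ℂ (χ k 0) * x + starRingEnd ℂ (χ k 1) * y)) * Complex.I_sq
  · congr 1
    simp; ring

/-- Averaging over the four momenta `k`, `π - k`, `-k`, `k - π`, which share the speed
`|velocity c k|`. -/
lemma integral_neg_pi_pi_eq {F : ℝ → ℂ} (hF : Continuous F) :
    ∫ k in (-Real.pi)..Real.pi, F k =
      ∫ k in (0 : ℝ)..(Real.pi / 2), (F k + F (Real.pi - k) + F (-k) + F (k - Real.pi)) := by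
  have hi : ∀ a b : ℝ, IntervalIntegrable F volume a b := fun a b => hF.intervalIntegrable a b
  rw [intervalIntegral.integral_add, intervalIntegral.integral_add, intervalIntegral.integral_add,
    intervalIntegral.integral_comp_sub_left F, intervalIntegral.integral_comp_neg F,
    intervalIntegral.integral_comp_sub_right F]
  · rw [← intervalIntegral.integral_add_adjacent_intervals
        (hi (-Real.pi) (-(Real.pi / 2))) (hi _ _),
      ← intervalIntegral.integral_add_adjacent_intervals (hi (-(Real.pi / 2)) 0) (hi _ _),
      ← intervalIntegral.integral_add_adjacent_intervals (hi 0 (Real.pi / 2)) (hi _ _)]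
    rw [sub_zero, neg_zero, zero_sub, show Real.pi - Real.pi / 2 = Real.pi / 2 by ring,
      show Real.pi / 2 - Real.pi = -(Real.pi / 2) by ring]
    ring
  all_goals exact Continuous.intervalIntegrable (by fun_prop) _ _

/-- The average of `⟨φ, H(k) φ⟩` over `k`, `π - k`, `-k`, `k - π` for `0 < k < π`, the last two
counted with a minus sign because their velocity is reversed. The `σ_y` contributions cancel. -/
noncomputable def asymmetry (θ : ℝ) (α β : ℂ) (k : ℝ) : ℝ :=
  (blochZ θ k * (‖α‖ ^ 2 - ‖β‖ ^ 2) + 2 * blochX θ k * (α * starRingEnd ℂ β).re) /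
    (Real.sin k * √(sineFactor (Real.cos θ) k))

lemma tendsto_integral_overlap {θ : ℝ} (hs : Real.sin θ ≠ 0) {α β : ℂ}
    (hαβ : ‖α‖ ^ 2 + ‖β‖ ^ 2 = 1) (ξ : ℝ) :
    Tendsto (fun t : ℕ => ∫ k in (-Real.pi)..Real.pi,
        overlap θ α β (3 * t) k (k - ξ * (3 * (t : ℝ))⁻¹)) atTop
      (𝓝 (∫ k in (0 : ℝ)..(Real.pi / 2),
        4 * ((Real.cos (ξ * velocity (Real.cos θ) k) : ℂ) -
          Complex.I * Real.sin (ξ * velocity (Real.cos θ) k) * asymmetry θ α β k))) := by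
  have hF : ∀ t : ℕ, Continuous fun k => overlap θ α β (3 * t) k (k - ξ * (3 * (t : ℝ))⁻¹) :=
    fun t => continuous_overlap θ α β _ continuous_id (continuous_id.sub continuous_const)
  simp_rw [fun t => integral_neg_pi_pi_eq (hF t)]
  refine intervalIntegral.tendsto_integral_filter_of_dominated_convergence (fun _ => 4) ?_ ?_ ?_ ?_
  · refine Eventually.of_forall fun t => Continuous.aestronglyMeasurable ?_
    exact (((hF t).add ((hF t).comp (continuous_const.sub continuous_id))).add
      ((hF t).comp continuous_neg)).add ((hF t).comp (continuous_id.sub continuous_const))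
  · refine Eventually.of_forall fun t => ae_of_all _ fun k _ => ?_
    have hb := fun k => norm_overlap_le θ hαβ (3 * t) k (k - ξ * (3 * (t : ℝ))⁻¹)
    refine (norm_add_le _ _).trans ?_
    refine (add_le_add_left (norm_add_le _ _) _).trans ?_
    refine (add_le_add_left (add_le_add_left (norm_add_le _ _) _) _).trans ?_
    linarith [hb k, hb (Real.pi - k), hb (-k), hb (k - Real.pi)]
  · exact intervalIntegrable_const
  · refine ae_of_all _ fun k hk => ?_
    rw [Set.uIoc_of_le (by positivity)] at hk
    have hsin : 0 < Real.sin k :=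
      Real.sin_pos_of_pos_of_lt_pi hk.1 (by linarith [hk.2, Real.pi_pos])
    have hQ := sineFactor_pos (cos_sq_lt_one hs) k
    have hQs : √(sineFactor (Real.cos θ) k) ≠ 0 := by positivity
    have c1 : Real.cos (k - Real.pi) = -Real.cos k := Real.cos_sub_pi k
    have s1 : Real.sin (k - Real.pi) = -Real.sin k := Real.sin_sub_pi k
    have h1 := tendsto_overlap hs hαβ hsin.ne' ξ
    have h2 := tendsto_overlap hs hαβ (k := Real.pi - k) (by rw [Real.sin_pi_sub]; exact hsin.ne') ξ
    have h3 := tendsto_overlap hs hαβ (k := -k)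
      (by rw [Real.sin_neg]; exact neg_ne_zero.2 hsin.ne') ξ
    have h4 := tendsto_overlap hs hαβ (k := k - Real.pi)
      (by rw [s1]; exact neg_ne_zero.2 hsin.ne') ξ
    have hv : Real.sin k * slopeFactor (Real.cos θ) k /
        (3 * (Real.sin k * √(sineFactor (Real.cos θ) k))) = velocity (Real.cos θ) k := by
      rw [velocity]; field_simp
    refine (((h1.add h2).add h3).add h4).trans_eq ?_
    congr 1
    simp only [sinPhase_eq, slopeFactor, sineFactor, blochExpectation, blochX, blochY, blochZ,
      Real.sin_pi_sub, Real.cos_pi_sub, Real.sin_neg, Real.cos_neg, c1, s1, neg_sq, abs_neg,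
      abs_of_pos hsin] at hv ⊢
    rw [neg_mul (Real.sin k), neg_div, hv, mul_neg ξ, Real.cos_neg, Real.sin_neg]
    rw [asymmetry, sineFactor, blochX, blochZ]
    push_cast
    ring

/-! ### The density in terms of the velocity -/

lemma continuous_slopeFactor (c : ℝ) : Continuous (slopeFactor c) := by
  unfold slopeFactor; fun_prop

lemma continuous_sineFactor (c : ℝ) : Continuous (sineFactor c) := by
  unfold sineFactor; fun_prop

lemma continuous_velocity {c : ℝ} (hc : c ^ 2 < 1) : Continuous (velocity c) := by
  have := continuous_slopeFactor c
  have := continuous_sineFactor c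
  unfold velocity
  refine Continuous.div (by fun_prop) (by fun_prop) fun k => ?_
  have := sineFactor_pos hc k
  positivity

/-- The derivative of `velocity c`. -/
noncomputable def velocityDeriv (c k : ℝ) : ℝ :=
  -(16 * c ^ 2 * (1 - c ^ 2) * (Real.sin k * Real.cos k) *
    (1 + 4 * c ^ 2 + 4 * c ^ 2 * Real.cos k ^ 2)) / (3 * (sineFactor c k * √(sineFactor c k)))

lemma hasDerivAt_velocity {c : ℝ} (hc : c ^ 2 < 1) (k : ℝ) :
    HasDerivAt (velocity c) (velocityDeriv c k) k := by
  have hQ := sineFactor_pos hc k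
  have hcos : HasDerivAt (fun k => Real.cos k ^ 2) (2 * Real.cos k * -Real.sin k) k := by
    simpa using (Real.hasDerivAt_cos k).fun_pow 2
  have hr : HasDerivAt (slopeFactor c) (12 * c ^ 2 * (2 * Real.cos k * -Real.sin k)) k :=
    (hcos.const_mul (12 * c ^ 2)).const_add (1 - 4 * c ^ 2)
  have hq := hcos.const_mul (4 * c ^ 2)
  have hQ' : HasDerivAt (sineFactor c) ((2 - 4 * c ^ 2) *
      (4 * c ^ 2 * (2 * Real.cos k * -Real.sin k)) + 2 * (4 * c ^ 2 * Real.cos k ^ 2) *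
      (4 * c ^ 2 * (2 * Real.cos k * -Real.sin k))) k := by
    have := ((hq.const_mul (2 - 4 * c ^ 2)).const_add 1).add (hq.fun_pow 2)
    exact HasDerivAt.congr_deriv (f := sineFactor c) this (by simp)
  have h := hr.div ((hQ'.sqrt hQ.ne').const_mul 3) (by positivity)
  refine h.congr_deriv ?_
  have hs : √(sineFactor c k) ^ 2 = sineFactor c k := Real.sq_sqrt hQ.le
  have hs0 : √(sineFactor c k) ≠ 0 := by positivity
  rw [velocityDeriv, ← hs, Real.sqrt_sq (Real.sqrt_nonneg _)]
  field_simp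
  rw [hs, slopeFactor, sineFactor]
  ring

lemma velocityDeriv_neg {c : ℝ} (hc0 : c ≠ 0) (hc : c ^ 2 < 1) {k : ℝ}
    (hk : k ∈ Set.Ioo 0 (Real.pi / 2)) : velocityDeriv c k < 0 := by
  have hQ := sineFactor_pos hc k
  have h1 : 0 < Real.sin k := Real.sin_pos_of_pos_of_lt_pi hk.1 (by linarith [hk.2, Real.pi_pos])
  have h2 : 0 < Real.cos k := Real.cos_pos_of_mem_Ioo ⟨by linarith [hk.1, hk.2], hk.2⟩
  have h3 : 0 < 1 - c ^ 2 := by linarith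
  have h4 : 0 < c ^ 2 := by positivity
  unfold velocityDeriv
  exact div_neg_of_neg_of_pos (neg_neg_of_pos (by positivity)) (by positivity)

lemma strictAntiOn_velocity {c : ℝ} (hc0 : c ≠ 0) (hc : c ^ 2 < 1) :
    StrictAntiOn (velocity c) (Set.Icc 0 (Real.pi / 2)) := by
  refine strictAntiOn_of_deriv_neg (convex_Icc _ _) (continuous_velocity hc).continuousOn
    fun k hk => ?_
  rw [interior_Icc] at hk
  rw [(hasDerivAt_velocity hc k).deriv]
  exact velocityDeriv_neg hc0 hc hk

lemma velocity_zero (c : ℝ) : velocity c 0 = √(1 + 8 * c ^ 2) / 3 := by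
  have h1 : slopeFactor c 0 = 1 + 8 * c ^ 2 := by simp [slopeFactor]; ring
  have h2 : sineFactor c 0 = 1 + 8 * c ^ 2 := by simp [sineFactor]; ring
  rw [velocity, h1, h2, mul_comm (3 : ℝ) (√_), ← div_div, Real.div_sqrt]

lemma velocity_pi_div_two (c : ℝ) : velocity c (Real.pi / 2) = (1 - 4 * c ^ 2) / 3 := by
  simp [velocity, slopeFactor, sineFactor]

lemma image_velocity {c : ℝ} (hc0 : c ≠ 0) (hc : c ^ 2 < 1) :
    velocity c '' Set.Ioo 0 (Real.pi / 2) =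
      Set.Ioo ((1 - 4 * c ^ 2) / 3) (√(1 + 8 * c ^ 2) / 3) := by
  have hπ : (0 : ℝ) ≤ Real.pi / 2 := by positivity
  have h := strictAntiOn_velocity hc0 hc
  rw [← velocity_zero, ← velocity_pi_div_two]
  apply Set.Subset.antisymm
  · rintro _ ⟨k, hk, rfl⟩
    exact ⟨h ⟨hk.1.le, hk.2.le⟩ ⟨hπ, le_rfl⟩ hk.2, h ⟨le_rfl, hπ⟩ ⟨hk.1.le, hk.2.le⟩ hk.1⟩
  · exact intermediate_value_Ioo' hπ (continuous_velocity hc).continuousOn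

lemma one_sub_velocity_sq {c : ℝ} (hc : c ^ 2 < 1) (k : ℝ) :
    1 - velocity c k ^ 2 =
      4 * (1 - c ^ 2) * (2 + 4 * c ^ 2 + 12 * c ^ 2 * Real.cos k ^ 2) / (9 * sineFactor c k) := by
  have hQ := sineFactor_pos hc k
  rw [velocity, div_pow, mul_pow, Real.sq_sqrt hQ.le]
  field_simp
  rw [slopeFactor, sineFactor]
  ring

lemma sqrt_D_velocity {c s : ℝ} (hcs : s ^ 2 + c ^ 2 = 1) (hc : c ^ 2 < 1) (k : ℝ) :
    √(D c (velocity c k)) =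
      |s| * (1 + 4 * c ^ 2 + 4 * c ^ 2 * Real.cos k ^ 2) / √(sineFactor c k) := by
  have hQ := sineFactor_pos hc k
  rw [Real.sqrt_eq_iff_mul_self_eq_of_pos]
  · rw [div_mul_div_comm, Real.mul_self_sqrt hQ.le, D, velocity, div_pow, mul_pow,
      Real.sq_sqrt hQ.le]
    have : |s| * |s| = 1 - c ^ 2 := by rw [abs_mul_abs_self]; linarith
    rw [mul_mul_mul_comm, this]
    field_simp
    rw [slopeFactor, sineFactor]
    ring
  · have hs : s ≠ 0 := by
      rintro rfl
      linarith
    positivity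

lemma Wplus_velocity {c s : ℝ} (hcs : s ^ 2 + c ^ 2 = 1) (hc : c ^ 2 < 1) (k : ℝ) :
    Wplus c s (velocity c k) = (1 - velocity c k ^ 2) * (12 * c ^ 2 * Real.cos k ^ 2) := by
  have hQ := sineFactor_pos hc k
  have hs : |s| * |s| = 1 - c ^ 2 := by rw [abs_mul_abs_self]; linarith
  have hQs : √(sineFactor c k) ^ 2 = sineFactor c k := Real.sq_sqrt hQ.le
  have e : 2 * |s| * velocity c k * √(D c (velocity c k)) =
      2 * (1 - c ^ 2) * slopeFactor c k * (1 + 4 * c ^ 2 + 4 * c ^ 2 * Real.cos k ^ 2) /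
        (3 * sineFactor c k) := by
    rw [sqrt_D_velocity hcs hc, velocity, ← hs, ← hQs]
    field_simp
    simp only [hQs]
  rw [Wplus, e, velocity, div_pow, mul_pow, hQs]
  field_simp
  rw [slopeFactor, sineFactor]
  ring

lemma Wminus_velocity {c s : ℝ} (hcs : s ^ 2 + c ^ 2 = 1) (hc : c ^ 2 < 1) (k : ℝ) :
    Wminus c s (velocity c k) = (1 - velocity c k ^ 2) * (12 * c ^ 2 * Real.sin k ^ 2) := by
  have h := Wplus_velocity hcs hc k
  rw [Real.sin_sq]
  rw [Wplus] at h
  rw [Wminus]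
  linarith

/-- The function `f` is the Jacobian factor of the change of variables `y = velocity c k`. -/
lemma abs_velocityDeriv_mul_f {c s : ℝ} (hcs : s ^ 2 + c ^ 2 = 1) (hc0 : c ≠ 0) (hc : c ^ 2 < 1)
    {k : ℝ} (hk : k ∈ Set.Ioo 0 (Real.pi / 2)) :
    |velocityDeriv c k| * f c s (velocity c k) = Real.pi⁻¹ := by
  have hQ := sineFactor_pos hc k
  have h1 : 0 < Real.sin k := Real.sin_pos_of_pos_of_lt_pi hk.1 (by linarith [hk.2, Real.pi_pos])
  have h2 : 0 < Real.cos k := Real.cos_pos_of_mem_Ioo ⟨by linarith [hk.1, hk.2], hk.2⟩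
  have h3 : 0 < 1 - c ^ 2 := by linarith
  have h4 : 0 < c ^ 2 := by positivity
  have hs0 : s ≠ 0 := by
    rintro rfl
    linarith
  have hs : |s| * |s| = 1 - c ^ 2 := by rw [abs_mul_abs_self]; linarith
  have hsq : √(sineFactor c k) ^ 2 = sineFactor c k := Real.sq_sqrt hQ.le
  have hy := one_sub_velocity_sq hc k
  have hm : 0 < 2 + 4 * c ^ 2 + 12 * c ^ 2 * Real.cos k ^ 2 := by positivity
  have hn : 0 < 1 + 4 * c ^ 2 + 4 * c ^ 2 * Real.cos k ^ 2 := by positivity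
  have hy0 : 0 < 1 - velocity c k ^ 2 := by rw [hy]; positivity
  have hW : √(Wplus c s (velocity c k)) * √(Wminus c s (velocity c k)) =
      (1 - velocity c k ^ 2) * (12 * c ^ 2 * (Real.sin k * Real.cos k)) := by
    rw [Wplus_velocity hcs hc, Wminus_velocity hcs hc, ← Real.sqrt_mul (by positivity)]
    rw [show (1 - velocity c k ^ 2) * (12 * c ^ 2 * Real.cos k ^ 2) *
      ((1 - velocity c k ^ 2) * (12 * c ^ 2 * Real.sin k ^ 2)) =
      ((1 - velocity c k ^ 2) * (12 * c ^ 2 * (Real.sin k * Real.cos k))) ^ 2 by ring]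
    exact Real.sqrt_sq (by positivity)
  have hN : |s| * velocity c k + √(D c (velocity c k)) =
      2 * |s| * (2 + 4 * c ^ 2 + 12 * c ^ 2 * Real.cos k ^ 2) / (3 * √(sineFactor c k)) := by
    rw [sqrt_D_velocity hcs hc, velocity, slopeFactor]
    field_simp
    ring
  rw [abs_of_neg (velocityDeriv_neg hc0 hc hk), f, hN, mul_assoc (Real.pi * _), hW,
    sqrt_D_velocity hcs hc, hy, velocityDeriv, ← hs]
  generalize 2 + 4 * c ^ 2 + 12 * c ^ 2 * Real.cos k ^ 2 = m at *
  generalize 1 + 4 * c ^ 2 + 4 * c ^ 2 * Real.cos k ^ 2 = n at *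
  have hQs : 0 < √(sineFactor c k) := by positivity
  rw [← hsq, Real.sqrt_sq hQs.le]
  have hs1 : 0 < |s| := by positivity
  field_simp
  norm_num

lemma f_velocity_nonneg {c s : ℝ} (hcs : s ^ 2 + c ^ 2 = 1) (hc0 : c ≠ 0) (hc : c ^ 2 < 1)
    {k : ℝ} (hk : k ∈ Set.Ioo 0 (Real.pi / 2)) : 0 ≤ f c s (velocity c k) := by
  have h := abs_velocityDeriv_mul_f hcs hc0 hc hk
  have h1 : 0 < |velocityDeriv c k| := abs_pos.2 (velocityDeriv_neg hc0 hc hk).ne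
  have h2 : 0 < |velocityDeriv c k| * f c s (velocity c k) := by rw [h]; positivity
  exact (pos_of_mul_pos_right h2 h1.le).le

lemma nu_velocity {θ : ℝ} (hc : Real.cos θ ≠ 0) (hs : Real.sin θ ≠ 0) (α β : ℂ) {k : ℝ}
    (hk : Real.sin k ≠ 0) :
    nu (Real.cos θ) (Real.sin θ) α β (velocity (Real.cos θ) k) = asymmetry θ α β k := by
  have hQ := sineFactor_pos (cos_sq_lt_one hs) k
  have hcs := Real.sin_sq_add_cos_sq θ
  rw [nu, sqrt_D_velocity hcs (cos_sq_lt_one hs), velocity, asymmetry, blochX, blochZ, slopeFactor,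
    Real.sin_sq k]
  generalize sineFactor (Real.cos θ) k = Q at *
  have hQs : 0 < √Q := by positivity
  generalize √Q = g at *
  generalize Real.sin k = S at *
  generalize Real.cos k = C at *
  generalize ‖α‖ ^ 2 - ‖β‖ ^ 2 = A
  generalize (α * starRingEnd ℂ β).re = R
  generalize Real.cos θ = c at *
  generalize Real.sin θ = s at *
  have hs1 : 0 < |s| := by positivity
  have h8 : 0 < 1 + 8 * c ^ 2 := by positivity
  have hs2 : s ^ 2 = 1 - c ^ 2 := by linarith
  field_simp
  rw [hs2]
  linear_combination (3 * c * A + 12 * c ^ 3 * A + 12 * c ^ 3 * A * C ^ 2) * hs2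

lemma abs_asymmetry_le_one {θ : ℝ} (hs : Real.sin θ ≠ 0) {α β : ℂ}
    (hαβ : ‖α‖ ^ 2 + ‖β‖ ^ 2 = 1) {k : ℝ} (hk : Real.sin k ≠ 0) : |asymmetry θ α β k| ≤ 1 := by
  have hQ := sineFactor_pos (cos_sq_lt_one hs) k
  rw [asymmetry, abs_div, abs_mul (Real.sin k), abs_of_pos (Real.sqrt_pos.2 hQ), ← sinPhase_eq,
    div_le_one (sinPhase_pos hs hk)]
  refine abs_le_of_sq_le_sq ?_ (sinPhase_pos hs hk).le
  rw [sinPhase_sq_eq_bloch_sq]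
  have hR : (α * starRingEnd ℂ β).re ^ 2 ≤ ‖α‖ ^ 2 * ‖β‖ ^ 2 := by
    have h := Complex.abs_re_le_norm (α * starRingEnd ℂ β)
    rw [norm_mul, RCLike.norm_conj] at h
    rw [← mul_pow]
    exact sq_le_sq' (by linarith [neg_abs_le (α * starRingEnd ℂ β).re]) ((le_abs_self _).trans h)
  -- The Bloch vector of the initial coin state is a unit vector.
  have hA : (‖α‖ ^ 2 - ‖β‖ ^ 2) ^ 2 + (2 * (α * starRingEnd ℂ β).re) ^ 2 ≤ 1 := by
    have : (‖α‖ ^ 2 + ‖β‖ ^ 2) ^ 2 = 1 := by rw [hαβ, one_pow]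
    nlinarith
  generalize ‖α‖ ^ 2 - ‖β‖ ^ 2 = A at *
  generalize (α * starRingEnd ℂ β).re = R at *
  have h1 : (blochZ θ k * A + 2 * blochX θ k * R) ^ 2 ≤
      (blochX θ k ^ 2 + blochZ θ k ^ 2) * (A ^ 2 + (2 * R) ^ 2) := by
    nlinarith [sq_nonneg (blochX θ k * A - blochZ θ k * (2 * R))]
  have h2 : (blochX θ k ^ 2 + blochZ θ k ^ 2) * (A ^ 2 + (2 * R) ^ 2) ≤
      (blochX θ k ^ 2 + blochZ θ k ^ 2) * 1 := by gcongr
  nlinarith [sq_nonneg (blochY θ k)]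

lemma measurable_asymmetry (θ : ℝ) (α β : ℂ) : Measurable (asymmetry θ α β) := by
  have := (continuous_blochX θ).measurable
  have := (continuous_blochZ θ).measurable
  have := (continuous_sineFactor (Real.cos θ)).measurable
  unfold asymmetry
  fun_prop

lemma integrableOn_f_smul {E : Type*} [NormedAddCommGroup E] [NormedSpace ℝ E] {c s : ℝ}
    (hcs : s ^ 2 + c ^ 2 = 1) (hc0 : c ≠ 0) (hc : c ^ 2 < 1)
    {h g : ℝ → E} (hg : StronglyMeasurable g) (C : ℝ)
    (hC : ∀ k ∈ Set.Ioo 0 (Real.pi / 2), ‖g k‖ ≤ C)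
    (hhg : ∀ k ∈ Set.Ioo 0 (Real.pi / 2), h (velocity c k) = g k) :
    IntegrableOn (fun y => f c s y • h y)
      (Set.Ioo ((1 - 4 * c ^ 2) / 3) (√(1 + 8 * c ^ 2) / 3)) := by
  rw [← image_velocity hc0 hc, integrableOn_image_iff_integrableOn_abs_deriv_smul measurableSet_Ioo
    (fun k _ => (hasDerivAt_velocity hc k).hasDerivWithinAt)
    ((strictAntiOn_velocity hc0 hc).injOn.mono Set.Ioo_subset_Icc_self)]
  have h1 : IntegrableOn (fun k => Real.pi⁻¹ • g k) (Set.Ioo 0 (Real.pi / 2)) := by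
    refine Integrable.smul _ (Measure.integrableOn_of_bounded (M := C) (by simp)
      hg.aestronglyMeasurable ?_)
    exact (ae_restrict_iff' measurableSet_Ioo).2 (ae_of_all _ hC)
  refine h1.congr_fun (fun k hk => ?_) measurableSet_Ioo
  simp only
  rw [smul_smul, abs_velocityDeriv_mul_f hcs hc0 hc hk, hhg k hk]

lemma setIntegral_f_smul {E : Type*} [NormedAddCommGroup E] [NormedSpace ℝ E] {c s : ℝ}
    (hcs : s ^ 2 + c ^ 2 = 1) (hc0 : c ≠ 0) (hc : c ^ 2 < 1)
    {h g : ℝ → E} (hhg : ∀ k ∈ Set.Ioo 0 (Real.pi / 2), h (velocity c k) = g k) :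
    ∫ y in Set.Ioo ((1 - 4 * c ^ 2) / 3) (√(1 + 8 * c ^ 2) / 3), f c s y • h y =
      ∫ k in Set.Ioo 0 (Real.pi / 2), Real.pi⁻¹ • g k := by
  rw [← image_velocity hc0 hc, integral_image_eq_integral_abs_deriv_smul measurableSet_Ioo
    (fun k _ => (hasDerivAt_velocity hc k).hasDerivWithinAt)
    ((strictAntiOn_velocity hc0 hc).injOn.mono Set.Ioo_subset_Icc_self)]
  refine setIntegral_congr_fun measurableSet_Ioo fun k hk => ?_
  rw [smul_smul, abs_velocityDeriv_mul_f hcs hc0 hc hk, hhg k hk]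

/-! ### The limit law -/

/-- The limit density integrates test functions as the momentum-space distribution of the group
velocity does. -/
lemma integrable_density_smul_and_integral {θ : ℝ} (hc : Real.cos θ ≠ 0) (hs : Real.sin θ ≠ 0)
    {α β : ℂ} (hαβ : ‖α‖ ^ 2 + ‖β‖ ^ 2 = 1) {E : Type*} [NormedAddCommGroup E] [NormedSpace ℝ E]
    {g : ℝ → E} (hg : Continuous g) {C : ℝ} (hC : ∀ y, ‖g y‖ ≤ C) :
    Integrable (fun y => density (Real.cos θ) (Real.sin θ) α β y • g y) ∧
    ∫ y, density (Real.cos θ) (Real.sin θ) α β y • g y =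
      ∫ k in Set.Ioo 0 (Real.pi / 2), Real.pi⁻¹ •
        ((1 - asymmetry θ α β k) • g (velocity (Real.cos θ) k) +
          (1 + asymmetry θ α β k) • g (-velocity (Real.cos θ) k)) := by
  have hcs := Real.sin_sq_add_cos_sq θ
  have hc1 := cos_sq_lt_one hs
  have hv := continuous_velocity hc1
  have hC0 : 0 ≤ C := (norm_nonneg _).trans (hC 0)
  have hsin : ∀ k ∈ Set.Ioo 0 (Real.pi / 2), Real.sin k ≠ 0 := fun k hk =>
    (Real.sin_pos_of_pos_of_lt_pi hk.1 (by linarith [hk.2, Real.pi_pos])).ne'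
  have ha : ∀ k ∈ Set.Ioo 0 (Real.pi / 2), |asymmetry θ α β k| ≤ 1 := fun k hk =>
    abs_asymmetry_le_one hs hαβ (hsin k hk)
  set I := Set.Ioo ((1 - 4 * Real.cos θ ^ 2) / 3) (√(1 + 8 * Real.cos θ ^ 2) / 3) with hI
  set h₁ : ℝ → E := fun y => (1 - nu (Real.cos θ) (Real.sin θ) α β y) • g y with hh₁
  set h₂ : ℝ → E := fun y => (1 + nu (Real.cos θ) (Real.sin θ) α β y) • g (-y) with hh₂
  set g₁ : ℝ → E := fun k => (1 - asymmetry θ α β k) • g (velocity (Real.cos θ) k) with hg₁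
  set g₂ : ℝ → E := fun k => (1 + asymmetry θ α β k) • g (-velocity (Real.cos θ) k) with hg₂
  have e₁ : ∀ k ∈ Set.Ioo 0 (Real.pi / 2), h₁ (velocity (Real.cos θ) k) = g₁ k := fun k hk => by
    rw [hh₁, hg₁]; simp only [nu_velocity hc hs α β (hsin k hk)]
  have e₂ : ∀ k ∈ Set.Ioo 0 (Real.pi / 2), h₂ (velocity (Real.cos θ) k) = g₂ k := fun k hk => by
    rw [hh₂, hg₂]; simp only [nu_velocity hc hs α β (hsin k hk)]
  have m₁ : StronglyMeasurable g₁ :=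
    (measurable_const.sub (measurable_asymmetry θ α β)).stronglyMeasurable.smul
      (hg.comp hv).stronglyMeasurable
  have m₂ : StronglyMeasurable g₂ :=
    (measurable_const.add (measurable_asymmetry θ α β)).stronglyMeasurable.smul
      (hg.comp hv.neg).stronglyMeasurable
  have b₁ : ∀ k ∈ Set.Ioo 0 (Real.pi / 2), ‖g₁ k‖ ≤ 2 * C := fun k hk => by
    have := abs_le.1 (ha k hk)
    rw [hg₁, norm_smul, Real.norm_eq_abs]
    exact mul_le_mul (abs_le.2 ⟨by linarith, by linarith⟩) (hC _) (norm_nonneg _) zero_le_two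
  have b₂ : ∀ k ∈ Set.Ioo 0 (Real.pi / 2), ‖g₂ k‖ ≤ 2 * C := fun k hk => by
    have := abs_le.1 (ha k hk)
    rw [hg₂, norm_smul, Real.norm_eq_abs]
    exact mul_le_mul (abs_le.2 ⟨by linarith, by linarith⟩) (hC _) (norm_nonneg _) zero_le_two
  have i₁ := integrableOn_f_smul hcs hc hc1 m₁ (2 * C) b₁ e₁
  have i₂ := integrableOn_f_smul hcs hc hc1 m₂ (2 * C) b₂ e₂
  have hdens : (fun y => density (Real.cos θ) (Real.sin θ) α β y • g y) = fun y =>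
      I.indicator (fun y => f (Real.cos θ) (Real.sin θ) y • h₁ y) y +
        I.indicator (fun y => f (Real.cos θ) (Real.sin θ) y • h₂ y) (-y) := by
    funext y
    have hm : (y ∈ Set.Ioo (-(√(1 + 8 * Real.cos θ ^ 2) / 3)) (-((1 - 4 * Real.cos θ ^ 2) / 3))) ↔
        -y ∈ I := by
      simp only [hI, Set.mem_Ioo]
      constructor <;> rintro ⟨h, h'⟩ <;> constructor <;> linarith
    rw [density, add_smul]
    congr 1
    · by_cases hy : y ∈ I
      · rw [Set.indicator_of_mem hy, Set.indicator_of_mem hy, hh₁, smul_smul, mul_comm]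
      · rw [Set.indicator_of_notMem hy, Set.indicator_of_notMem hy, zero_smul]
    · by_cases hy : -y ∈ I
      · rw [Set.indicator_of_mem (hm.2 hy), Set.indicator_of_mem hy, hh₂]
        simp only
        rw [smul_smul, mul_comm, neg_neg]
      · rw [Set.indicator_of_notMem (mt hm.1 hy), Set.indicator_of_notMem hy, zero_smul]
  have j₁ := (integrable_indicator_iff measurableSet_Ioo).2 i₁
  have j₂ := (integrable_indicator_iff measurableSet_Ioo).2 i₂
  rw [hdens]
  refine ⟨j₁.add j₂.comp_neg, ?_⟩
  have hb : ∀ u : ℝ → E, StronglyMeasurable u → (∀ k ∈ Set.Ioo 0 (Real.pi / 2), ‖u k‖ ≤ 2 * C) →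
      IntegrableOn (fun k => Real.pi⁻¹ • u k) (Set.Ioo 0 (Real.pi / 2)) := fun u hu hu' =>
    Integrable.smul _ (Measure.integrableOn_of_bounded (M := 2 * C) (by simp)
      hu.aestronglyMeasurable ((ae_restrict_iff' measurableSet_Ioo).2 (ae_of_all _ hu')))
  rw [integral_add j₁ j₂.comp_neg, integral_neg_eq_self
    (I.indicator fun y => f (Real.cos θ) (Real.sin θ) y • h₂ y),
    integral_indicator measurableSet_Ioo, integral_indicator measurableSet_Ioo,
    setIntegral_f_smul hcs hc hc1 e₁, setIntegral_f_smul hcs hc hc1 e₂,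
    ← integral_add (hb _ m₁ b₁) (hb _ m₂ b₂)]
  simp only [smul_add, hg₁, hg₂]

lemma density_nonneg {θ : ℝ} (hc : Real.cos θ ≠ 0) (hs : Real.sin θ ≠ 0)
    {α β : ℂ} (hαβ : ‖α‖ ^ 2 + ‖β‖ ^ 2 = 1) (y : ℝ) :
    0 ≤ density (Real.cos θ) (Real.sin θ) α β y := by
  have hcs := Real.sin_sq_add_cos_sq θ
  have hc1 := cos_sq_lt_one hs
  have key : ∀ y ∈ Set.Ioo ((1 - 4 * Real.cos θ ^ 2) / 3) (√(1 + 8 * Real.cos θ ^ 2) / 3),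
      |nu (Real.cos θ) (Real.sin θ) α β y| ≤ 1 ∧ 0 ≤ f (Real.cos θ) (Real.sin θ) y := by
    intro y hy
    rw [← image_velocity hc hc1] at hy
    obtain ⟨k, hk, rfl⟩ := hy
    have hsin : Real.sin k ≠ 0 :=
      (Real.sin_pos_of_pos_of_lt_pi hk.1 (by linarith [hk.2, Real.pi_pos])).ne'
    rw [nu_velocity hc hs α β hsin]
    exact ⟨abs_asymmetry_le_one hs hαβ hsin, f_velocity_nonneg hcs hc hc1 hk⟩
  refine add_nonneg (Set.indicator_nonneg (fun y hy => ?_) y)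
    (Set.indicator_nonneg (fun y hy => ?_) y)
  · obtain ⟨h1, h2⟩ := key y hy
    exact mul_nonneg (by linarith [(abs_le.1 h1).2]) h2
  · obtain ⟨h1, h2⟩ := key (-y) ⟨by linarith [hy.2], by linarith [hy.1]⟩
    exact mul_nonneg (by linarith [(abs_le.1 h1).1]) h2

lemma integrable_density {θ : ℝ} (hc : Real.cos θ ≠ 0) (hs : Real.sin θ ≠ 0)
    {α β : ℂ} (hαβ : ‖α‖ ^ 2 + ‖β‖ ^ 2 = 1) :
    Integrable (density (Real.cos θ) (Real.sin θ) α β) := by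
  simpa using (integrable_density_smul_and_integral hc hs hαβ (g := fun _ => (1 : ℝ))
    continuous_const (C := 1) (by simp)).1

lemma integral_density {θ : ℝ} (hc : Real.cos θ ≠ 0) (hs : Real.sin θ ≠ 0)
    {α β : ℂ} (hαβ : ‖α‖ ^ 2 + ‖β‖ ^ 2 = 1) :
    ∫ y, density (Real.cos θ) (Real.sin θ) α β y = 1 := by
  have h := (integrable_density_smul_and_integral hc hs hαβ (g := fun _ => (1 : ℝ))
    continuous_const (C := 1) (by simp)).2
  simp only [smul_eq_mul, mul_one] at h
  rw [h]
  have : ∀ k, Real.pi⁻¹ * (1 - asymmetry θ α β k + (1 + asymmetry θ α β k)) = 2 * Real.pi⁻¹ :=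
    fun k => by ring
  simp only [this, setIntegral_const, Real.volume_real_Ioo_of_le (by positivity : 0 ≤ Real.pi / 2),
    smul_eq_mul]
  field_simp
  ring

/-- The limit law of `X_{3t} / (3t)`. -/
noncomputable def limitLaw (θ : ℝ) (α β : ℂ) : Measure ℝ :=
  volume.withDensity fun y => ENNReal.ofReal (density (Real.cos θ) (Real.sin θ) α β y)

lemma limitLaw_apply {θ : ℝ} (hc : Real.cos θ ≠ 0) (hs : Real.sin θ ≠ 0)
    {α β : ℂ} (hαβ : ‖α‖ ^ 2 + ‖β‖ ^ 2 = 1) {s : Set ℝ} (h : MeasurableSet s) :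
    limitLaw θ α β s = ENNReal.ofReal (∫ y in s, density (Real.cos θ) (Real.sin θ) α β y) := by
  rw [limitLaw, withDensity_apply _ h, ofReal_integral_eq_lintegral_ofReal
    (integrable_density hc hs hαβ).integrableOn (ae_of_all _ (density_nonneg hc hs hαβ))]

lemma isProbabilityMeasure_limitLaw {θ : ℝ} (hc : Real.cos θ ≠ 0) (hs : Real.sin θ ≠ 0)
    {α β : ℂ} (hαβ : ‖α‖ ^ 2 + ‖β‖ ^ 2 = 1) : IsProbabilityMeasure (limitLaw θ α β) := by
  constructor
  rw [limitLaw_apply hc hs hαβ MeasurableSet.univ, Measure.restrict_univ,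
    integral_density hc hs hαβ, ENNReal.ofReal_one]

lemma charFun_limitLaw {θ : ℝ} (hc : Real.cos θ ≠ 0) (hs : Real.sin θ ≠ 0)
    {α β : ℂ} (hαβ : ‖α‖ ^ 2 + ‖β‖ ^ 2 = 1) (ξ : ℝ) :
    charFun (limitLaw θ α β) ξ = (2 * (Real.pi : ℂ))⁻¹ * ∫ k in (0 : ℝ)..(Real.pi / 2),
        4 * ((Real.cos (ξ * velocity (Real.cos θ) k) : ℂ) -
          Complex.I * Real.sin (ξ * velocity (Real.cos θ) k) * asymmetry θ α β k) := by
  have hd := integrable_density hc hs hαβ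
  rw [charFun_apply_real, limitLaw, integral_withDensity_eq_integral_toReal_smul₀
    hd.aestronglyMeasurable.aemeasurable.ennreal_ofReal (by simp)]
  simp only [ENNReal.toReal_ofReal (density_nonneg hc hs hαβ _)]
  rw [(integrable_density_smul_and_integral hc hs hαβ
    (g := fun y : ℝ => Complex.exp (ξ * y * Complex.I)) (by fun_prop) (C := 1) fun y => by
      rw [← Complex.ofReal_mul, Complex.norm_exp_ofReal_mul_I]).2,
    intervalIntegral.integral_of_le (by positivity), integral_Ioc_eq_integral_Ioo,
    ← integral_const_mul]
  refine setIntegral_congr_fun measurableSet_Ioo fun k _ => ?_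
  have h1 : Complex.exp (ξ * (velocity (Real.cos θ) k : ℝ) * Complex.I) =
      Real.cos (ξ * velocity (Real.cos θ) k) +
        Real.sin (ξ * velocity (Real.cos θ) k) * Complex.I := by
    rw [Complex.exp_mul_I]; push_cast; rfl
  have h2 : Complex.exp (ξ * ((-velocity (Real.cos θ) k : ℝ) : ℂ) * Complex.I) =
      Real.cos (ξ * velocity (Real.cos θ) k) -
        Real.sin (ξ * velocity (Real.cos θ) k) * Complex.I := by
    rw [Complex.exp_mul_I, Complex.ofReal_neg, mul_neg, Complex.cos_neg, Complex.sin_neg]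
    push_cast; ring
  simp only [Complex.real_smul]
  rw [h1, h2]
  push_cast
  rw [mul_inv]
  ring

lemma tendsto_charFun_map_law {θ : ℝ} (hc : Real.cos θ ≠ 0) (hs : Real.sin θ ≠ 0)
    {α β : ℂ} (hαβ : ‖α‖ ^ 2 + ‖β‖ ^ 2 = 1) (ξ : ℝ) :
    Tendsto (fun t : ℕ => charFun ((law θ α β (3 * t)).map
      fun n : ℤ => (n : ℝ) * (3 * (t : ℝ))⁻¹) ξ) atTop (𝓝 (charFun (limitLaw θ α β) ξ)) := by
  simp_rw [charFun_limitLaw hc hs hαβ, charFun_map_law θ hαβ]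
  exact (tendsto_integral_overlap hs hαβ ξ).const_mul _

/-- Convergence of the distribution functions. All points are continuity points of the limit, which
is absolutely continuous. -/
lemma tendsto_law_real_le {θ : ℝ} (hc : Real.cos θ ≠ 0) (hs : Real.sin θ ≠ 0)
    {α β : ℂ} (hαβ : ‖α‖ ^ 2 + ‖β‖ ^ 2 = 1) (x : ℝ) :
    Tendsto (fun t : ℕ => (law θ α β (3 * t)).real {n : ℤ | (n : ℝ) / (3 * (t : ℝ)) ≤ x}) atTop
      (𝓝 (∫ y in Set.Iic x, density (Real.cos θ) (Real.sin θ) α β y)) := by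
  have hP := isProbabilityMeasure_law θ hαβ
  have hL := isProbabilityMeasure_limitLaw hc hs hαβ
  have hm : ∀ t : ℕ, Measurable fun n : ℤ => (n : ℝ) * (3 * (t : ℝ))⁻¹ := fun t => by fun_prop
  have hPm : ∀ t : ℕ, IsProbabilityMeasure ((law θ α β (3 * t)).map
      fun n : ℤ => (n : ℝ) * (3 * (t : ℝ))⁻¹) := fun t =>
    Measure.isProbabilityMeasure_map (hm t).aemeasurable
  let μ : ℕ → ProbabilityMeasure ℝ := fun t => ⟨_, hPm t⟩
  let ν : ProbabilityMeasure ℝ := ⟨_, hL⟩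
  have hconv : Tendsto μ atTop (𝓝 ν) :=
    ProbabilityMeasure.tendsto_iff_tendsto_charFun.2 (tendsto_charFun_map_law hc hs hαβ)
  have hfr : (ν : Measure ℝ) (frontier (Set.Iic x)) = 0 := by
    rw [frontier_Iic]
    exact withDensity_absolutelyContinuous _ _ Real.volume_singleton
  have h := ProbabilityMeasure.tendsto_measure_of_null_frontier_of_tendsto' hconv hfr
  have h' := (ENNReal.tendsto_toReal (measure_ne_top (ν : Measure ℝ) _)).comp h
  have e : ((ν : Measure ℝ) (Set.Iic x)).toReal =
      ∫ y in Set.Iic x, density (Real.cos θ) (Real.sin θ) α β y := by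
    change (limitLaw θ α β (Set.Iic x)).toReal = _
    rw [limitLaw_apply hc hs hαβ measurableSet_Iic,
      ENNReal.toReal_ofReal (integral_nonneg (density_nonneg hc hs hαβ))]
  rw [e] at h'
  refine h'.congr fun t => ?_
  change ((Measure.map _ _) (Set.Iic x)).toReal = _
  rw [Measure.map_apply (hm t) measurableSet_Iic]
  rfl

end PeriodicQW

theorem theorem1 (θ : ℝ) (hc : Real.cos θ ≠ 0) (hs : Real.sin θ ≠ 0)
    (α β : ℂ) (hαβ : ‖α‖ ^ 2 + ‖β‖ ^ 2 = 1) :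
    (∀ t : ℕ, IsProbabilityMeasure (PeriodicQW.law θ α β t)) ∧
    (∀ y : ℝ, 0 ≤ PeriodicQW.density (Real.cos θ) (Real.sin θ) α β y) ∧
    Integrable (PeriodicQW.density (Real.cos θ) (Real.sin θ) α β) volume ∧
    ∫ y : ℝ, PeriodicQW.density (Real.cos θ) (Real.sin θ) α β y = 1 ∧
    ∀ x : ℝ,
      Tendsto
        (fun t : ℕ => (PeriodicQW.law θ α β (3 * t)).real {n : ℤ | (n : ℝ) / (3 * (t : ℝ)) ≤ x})
        atTop
        (𝓝 (∫ y in Set.Iic x, PeriodicQW.density (Real.cos θ) (Real.sin θ) α β y)) :=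
  ⟨PeriodicQW.isProbabilityMeasure_law θ hαβ, PeriodicQW.density_nonneg hc hs hαβ,
    PeriodicQW.integrable_density hc hs hαβ, PeriodicQW.integral_density hc hs hαβ,
    PeriodicQW.tendsto_law_real_le hc hs hαβ⟩
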